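/- **Notation.** $z^*$ is complex conjugation, $S_-(z^{(1)},z^{(2)})^T=(-z^{(2)*},z^{(1)*})^T$, $W(g,h)=g^{(1)}h^{(2)}-g^{(2)}h^{(1)}$, $$U(\lambda,q,r)=\begin{pmatrix}-\lambda&q\\ r&\lambda\end{pmatrix},\quad V(\lambda,q,r)=i\begin{pmatrix}-2\lambda^2+qr&2\lambda q-q_x\\ 2\lambda r+r_x&2\lambda^2-qr\end{pmatrix},\quad H(\varphi)=\frac12\begin{pmatrix}-\varphi^{(1)}\varphi^{(2)}&(\varphi^{(1)})^2\\-(\varphi^{(2)})^2&\varphi^{(1)}\varphi^{(2)}\end{pmatrix}.$$ The NLS$^-$ equation with $m$ self-consistent sources (NLS$^-$ESCS) with parameters $\lambda_1,\dots,\lambda_m$ is $$\varphi_{j,x}=U(\lambda_j,q,-q^*)\varphi_j\ (1\le j\le m),\qquad q_t=i(-2|q|^2q-q_{xx})+\sum_{j=1}^m\big[(\varphi_j^{(1)})^2-(\varphi_j^{(2)*})^2\big],$$ and its Lax pair at the spectral parameter $\lambda$ is $$\psi_x=U(\lambda,q,-q^*)\psi,\qquad \psi_t=V(\lambda,q,-q^*)\psi+\sum_{j=1}^m\Big[\frac{H(\varphi_j)}{\lambda-\lambda_j}-\frac{H(S_-\varphi_j)}{\lambda+\lambda_j^*}\Big]\psi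 .$$ For vectors $g,h$ attached to spectral parameters $\mu\ne\nu$ put $\sigma(g,h)=-\frac{W(g,h)}{2(\mu-\nu)}$, and for $g=g(\mu)$ depending holomorphically on its parameter put $\sigma(g,g)=\frac12W(g,\partial_\mu g)$. If $g$ is attached to $\mu$, then $S_-g$ is attached to $-\mu^*$, with the parameter dependence $\mu\mapsto S_-(g(-\mu^*))$. For pairs $P_i=\{c_i,g_i\}$, $1\le i\le K$, put $A=(\delta_{ij}c_i+\sigma(g_i,g_j))_{i,j}$, $\alpha^{(k)}=(g_1^{(k)},\dots,g_K^{(k)})$, $b=(\sigma(g_1,h),\dots,\sigma(g_K,h))^T$ and $$W_0(P_1,\dots,P_K)=\det A,\quad W_1^{(k)}(P_1,\dots,P_K;h)=\det\begin{pmatrix}A&b\\ \alpha^{(k)}&h^{(k)}\end{pmatrix},\quad W_2^{(k)}(P_1,\dots,P_K;u)=\det\begin{pmatrix}A&(\alpha^{(k)})^T\\ \alpha^{(k)}&u\end{pmatrix},\quad W_1=(W_1^{(1)},W_1^{(2)})^T .$$ **Proposition.** Let $m,N\ge0$, let $\lambda_1,\dots,\lambda_{m+N}$ be complex numbers such that the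 $2(m+N)$ numbers $\lambda_j,-\lambda_j^*$ are distinct (in particular $\operatorname{Re}\lambda_j\ne0$), and let $(q,\varphi_1,\dots,\varphi_m)$ be a solution of the NLS$^-$ESCS with parameters $\lambda_1,\dots,\lambda_m$ on an open set $\Omega\subseteq\mathbb R^2$ of points $(x,t)$. For $1\le j\le N$ let $f_j=f_j(\lambda;x,t)$ be a solution of the Lax pair for all $\lambda$ in a neighbourhood of $\lambda_{m+j}$, holomorphic in $\lambda$ and continuously differentiable in $(\lambda,x,t)$, considered at $\lambda=\lambda_{m+j}$. Let $c_j(t)$ be complex functions, differentiable at every $t$ that occurs in $\Omega$, and let $\sqrt{\dot c_j}$ be any function whose square is $\dot c_j$. Put $F_j=\{c_j,f_j\}$, $F_j'=\{-c_j^*,S_-f_j\}$, $\Delta=W_0(F_1,F_1',\dots,F_N,F_N')$ and $$\bar\psi=\Delta^{-1}W_1(F_1,F'_1,\dots,F_N,F'_N;\psi),\qquad \bar q=q+\Delta^{-1}W_2^{(1)}(F_1,F'_1,\dots,F_N,F'_N;0),$$ $$\bar\varphi_j=\Delta^{-1}W_1(F_1,F'_1,\dots,F_N,F'_N;\varphi_j)\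 (1\le j\le m),\qquad \bar\varphi_{m+j}=\sqrt{\dot c_j}\,(c_j\Delta)^{-1}W_1(F_1,F'_1,\dots,F_N,F'_N;f_j)\ (1\le j\le N).$$ (1) If $\lambda$ is different from all $\lambda_j,-\lambda_j^*$ $(1\le j\le m+N)$ and $\psi$ solves the Lax pair of $(q,\varphi_1,\dots,\varphi_m)$ at $\lambda$ on $\Omega$, then $\bar\psi$ solves the Lax pair of $(\bar q,\bar\varphi_1,\dots,\bar\varphi_{m+N})$ (with $m+N$ sources and parameters $\lambda_1,\dots,\lambda_{m+N}$) at $\lambda$, at every point of $\Omega$ where $\Delta\ne0$ and all $c_j\ne0$. (2) $(\bar q,\bar\varphi_1,\dots,\bar\varphi_{m+N})$ solves the NLS$^-$ESCS with $m+N$ sources and parameters $\lambda_1,\dots,\lambda_{m+N}$ at every point of $\Omega$ where $\Delta\ne0$ and all $c_j\ne0$. (3) At every point of $\Omega$ where $\Delta\ne0$, $\Delta$ is real, $\log|\Delta|$ is twice differentiable in $x$, and $$|\bar q|^2=|q|^2+\partial_x^2\log|\Delta| .$$ -/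

import Mathlib

open Matrix Topology
open scoped ComplexConjugate

noncomputable section

namespace NLSMinus

/-- Vectors `(z⁽¹⁾, z⁽²⁾)` in `ℂ²`; the entry `z⁽¹⁾` is `z 0` and `z⁽²⁾` is `z 1`. -/
abbrev Vec2 := Fin 2 → ℂ

/-- The matrix `U(μ, q, r)` of the AKNS spectral problem. -/
def laxU (μ q r : ℂ) : Matrix (Fin 2) (Fin 2) ℂ :=
  !![-μ, q; r, μ]

/-- The matrix `V(μ, q, r)`, with `qx` and `rx` the `x`-derivatives of `q` and `r`. -/
def laxV (μ q r qx rx : ℂ) : Matrix (Fin 2) (Fin 2) ℂ :=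
  Complex.I • !![-2 * μ ^ 2 + q * r, 2 * μ * q - qx; 2 * μ * r + rx, 2 * μ ^ 2 - q * r]

/-- The matrix `H(φ)` of a source. -/
def sourceH (φ : Vec2) : Matrix (Fin 2) (Fin 2) ℂ :=
  (1 / 2 : ℂ) • !![-(φ 0 * φ 1), (φ 0) ^ 2; -(φ 1) ^ 2, φ 0 * φ 1]

/-- The map `S₋ : (z⁽¹⁾, z⁽²⁾) ↦ (-z⁽²⁾*, z⁽¹⁾*)`. -/
def sMinus (z : Vec2) : Vec2 := ![-conj (z 1), conj (z 0)]

/-- `g` is twice differentiable at the point `x`. -/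
def TwiceDifferentiableAt {E : Type*} [NormedAddCommGroup E] [NormedSpace ℝ E]
    (g : ℝ → E) (x : ℝ) : Prop :=
  (∀ᶠ y in 𝓝 x, DifferentiableAt ℝ g y) ∧ DifferentiableAt ℝ (deriv g) x

/-- The `2M` numbers `lam j`, `-(lam j)*` are distinct. For equal indices this says
`Re (lam j) ≠ 0`. -/
def DistinctSpectrum {M : ℕ} (lam : Fin M → ℂ) : Prop :=
  Function.Injective (Sum.elim lam (fun j => -conj (lam j)))

/-- `(q, φ₁, …, φ_m)` solves the NLS⁻ equation with `m` self-consistent sources at every point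
`(x, t)` of `Ω`: `φ_{j,x} = U(lam_j, q, -q*) φ_j` and
`q_t = i(-2|q|²q - q_xx) + ∑_j [(φ_j⁽¹⁾)² - (φ_j⁽²⁾*)²]`. -/
def IsNLSMinusSolution {m : ℕ} (Ω : Set (ℝ × ℝ)) (lam : Fin m → ℂ) (q : ℝ → ℝ → ℂ)
    (φ : Fin m → ℝ → ℝ → Vec2) : Prop :=
  ∀ x t : ℝ, (x, t) ∈ Ω →
    (∀ j, HasDerivAt (fun y => φ j y t)
      (laxU (lam j) (q x t) (-conj (q x t)) *ᵥ φ j x t) x) ∧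
    TwiceDifferentiableAt (fun y => q y t) x ∧
    HasDerivAt (fun τ => q x τ)
      (Complex.I * (-2 * (‖q x t‖ : ℂ) ^ 2 * q x t - deriv (deriv (fun y => q y t)) x)
        + ∑ j, ((φ j x t 0) ^ 2 - (conj (φ j x t 1)) ^ 2)) t

/-- `ψ` solves, at every point of `Ω`, the Lax pair of the NLS⁻ equation with sources at the
spectral parameter `μ`: `ψ_x = U(μ, q, -q*) ψ` and
`ψ_t = V(μ, q, -q*) ψ + ∑_j [H(φ_j) / (μ - lam_j) - H(S₋ φ_j) / (μ + lam_j*)] ψ`. -/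
def IsLaxSolution {m : ℕ} (Ω : Set (ℝ × ℝ)) (lam : Fin m → ℂ) (q : ℝ → ℝ → ℂ)
    (φ : Fin m → ℝ → ℝ → Vec2) (μ : ℂ) (ψ : ℝ → ℝ → Vec2) : Prop :=
  ∀ x t : ℝ, (x, t) ∈ Ω →
    HasDerivAt (fun y => ψ y t) (laxU μ (q x t) (-conj (q x t)) *ᵥ ψ x t) x ∧
    HasDerivAt (fun τ => ψ x τ)
      ((laxV μ (q x t) (-conj (q x t))
            (deriv (fun y => q y t) x) (-conj (deriv (fun y => q y t) x))
          + ∑ j, ((1 / (μ - lam j)) • sourceH (φ j x t)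
              - (1 / (μ + conj (lam j))) • sourceH (sMinus (φ j x t)))) *ᵥ ψ x t) t

/-- `f = f(z; x, t)` is a solution of the Lax pair at the parameter `μ` together with its
dependence on the spectral parameter: for `z` in a neighbourhood `D` of `μ` it solves the Lax
pair at `z`, it is holomorphic in `z`, and continuously differentiable in all its variables.
The dependence on `z` enters `σ(f, f) = W(f, ∂_μ f) / 2`. -/
def IsLaxFamily {m : ℕ} (Ω : Set (ℝ × ℝ)) (lam : Fin m → ℂ) (q : ℝ → ℝ → ℂ)
    (φ : Fin m → ℝ → ℝ → Vec2) (μ : ℂ) (f : ℂ → ℝ → ℝ → Vec2) : Prop :=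
  ∃ D : Set ℂ, IsOpen D ∧ μ ∈ D ∧
    ContDiffOn ℝ 1 (fun p : ℂ × ℝ × ℝ => f p.1 p.2.1 p.2.2) (D ×ˢ Ω) ∧
    (∀ x t : ℝ, (x, t) ∈ Ω → DifferentiableOn ℂ (fun z => f z x t) D) ∧
    ∀ z ∈ D, IsLaxSolution Ω lam q φ z (f z)

/-- A vector attached to the spectral parameter `param`, as the value at `param` of a
parameter-dependent family (at a fixed point `(x, t)`). -/
structure SpectralVector where
  param : ℂ
  family : ℂ → Vec2

/-- The vector itself. -/
def SpectralVector.value (g : SpectralVector) : Vec2 := g.family g.param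

/-- `S₋ g`, attached to the parameter `-μ*` if `g` is attached to `μ`. -/
def SpectralVector.sMinus (g : SpectralVector) : SpectralVector where
  param := -conj g.param
  family := fun z => NLSMinus.sMinus (g.family (-conj z))

/-- The Wronskian `W(f, g) = f⁽¹⁾ g⁽²⁾ - f⁽²⁾ g⁽¹⁾`. -/
def wronskian (f g : Vec2) : ℂ := f 0 * g 1 - f 1 * g 0

/-- `σ(g, h) = -W(g, h) / (2(μ - ν))` for vectors attached to parameters `μ ≠ ν`, and
`σ(g, g) = W(g, ∂_μ g) / 2`. -/
def sigma (g h : SpectralVector) : ℂ :=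
  open Classical in
  if g.param = h.param then wronskian g.value (deriv h.family g.param) / 2
  else -wronskian g.value h.value / (2 * (g.param - h.param))

/-- A pair `{c, g}`. -/
structure Pair where
  coef : ℂ
  vec : SpectralVector

section Forms

variable {ι : Type} [Fintype ι] [DecidableEq ι]

/-- The matrix `A = (δ_ij c_i + σ(g_i, g_j))`. -/
def matA (P : ι → Pair) : Matrix ι ι ℂ :=
  Matrix.of fun i j => (if i = j then (P i).coef else 0) + sigma (P i).vec (P j).vec

/-- The row `α⁽ᵏ⁾ = (g_1⁽ᵏ⁾, …, g_N⁽ᵏ⁾)`. -/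
def rowAlpha (P : ι → Pair) (k : Fin 2) : ι → ℂ := fun i => (P i).vec.value k

/-- `W_0 = det A`. -/
def formW0 (P : ι → Pair) : ℂ := (matA P).det

/-- `W_1(P; h)`, the vector with entries `det [A, b; α⁽ᵏ⁾, h⁽ᵏ⁾]`, where `b_i = σ(g_i, h)`. -/
def formW1 (P : ι → Pair) (h : SpectralVector) : Vec2 := fun k =>
  (Matrix.fromBlocks (matA P) (Matrix.replicateCol Unit fun i => sigma (P i).vec h)
    (Matrix.replicateRow Unit (rowAlpha P k)) (Matrix.of fun _ _ : Unit => h.value k)).det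

/-- `W_2⁽ᵏ⁾(P; u) = det [A, (α⁽ᵏ⁾)ᵀ; α⁽ᵏ⁾, u]`. -/
def formW2 (P : ι → Pair) (k : Fin 2) (u : ℂ) : ℂ :=
  (Matrix.fromBlocks (matA P) (Matrix.replicateCol Unit (rowAlpha P k))
    (Matrix.replicateRow Unit (rowAlpha P k)) (Matrix.of fun _ _ : Unit => u)).det

end Forms

section Transformation

variable {N : ℕ}

/-- The vector `f_j(μ_j; x, t)`, attached to the parameter `μ_j`. -/
def seed (mu : Fin N → ℂ) (f : Fin N → ℂ → ℝ → ℝ → Vec2) (x t : ℝ) (j : Fin N) :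
    SpectralVector where
  param := mu j
  family := fun z => f j z x t

/-- The `2N` pairs `F_j = {c_j, f_j}` (index `(j, false)`) and `F'_j = {-c_j*, S₋ f_j}`
(index `(j, true)`) at the point `(x, t)`. -/
def pairs (mu : Fin N → ℂ) (f : Fin N → ℂ → ℝ → ℝ → Vec2) (c : Fin N → ℝ → ℂ) (x t : ℝ) :
    Fin N × Bool → Pair
  | (j, false) => ⟨c j t, seed mu f x t j⟩
  | (j, true) => ⟨-conj (c j t), (seed mu f x t j).sMinus⟩

/-- `Δ = W_0(F_1, F'_1, …, F_N, F'_N)`. -/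
def Delta (mu : Fin N → ℂ) (f : Fin N → ℂ → ℝ → ℝ → Vec2) (c : Fin N → ℝ → ℂ) (x t : ℝ) : ℂ :=
  formW0 (pairs mu f c x t)

/-- `Δ⁻¹ W_1(F_1, F'_1, …, F_N, F'_N; ψ)` for `ψ` attached to the parameter `lam`, which is
different from all the `μ_j`, `-μ_j*`. -/
def barVec (mu : Fin N → ℂ) (f : Fin N → ℂ → ℝ → ℝ → Vec2) (c : Fin N → ℝ → ℂ)
    (lam : ℂ) (ψ : ℝ → ℝ → Vec2) (x t : ℝ) : Vec2 :=
  (Delta mu f c x t)⁻¹ • formW1 (pairs mu f c x t) ⟨lam, fun _ => ψ x t⟩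

/-- `q̄ = q + Δ⁻¹ W_2⁽¹⁾(F_1, F'_1, …, F_N, F'_N; 0)`. -/
def barQ (mu : Fin N → ℂ) (f : Fin N → ℂ → ℝ → ℝ → Vec2) (c : Fin N → ℝ → ℂ)
    (q : ℝ → ℝ → ℂ) (x t : ℝ) : ℂ :=
  q x t + (Delta mu f c x t)⁻¹ * formW2 (pairs mu f c x t) 0 0

/-- The new source `s_j (c_j Δ)⁻¹ W_1(F_1, F'_1, …, F_N, F'_N; f_j)`, where `s_j` is a square
root of the derivative of `c_j`. -/
def newSource (mu : Fin N → ℂ) (f : Fin N → ℂ → ℝ → ℝ → Vec2) (c s : Fin N → ℝ → ℂ)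
    (j : Fin N) (x t : ℝ) : Vec2 :=
  (s j t * (c j t * Delta mu f c x t)⁻¹) • formW1 (pairs mu f c x t) (seed mu f x t j)

/-- The sources `φ̄_1, …, φ̄_{m+N}`; the old eigenvalues are `lam j`, `j < m`, and the new ones
`μ_j = lam (m + j)`, `j < N`. -/
def barSources {m : ℕ} (lam : Fin (m + N) → ℂ) (f : Fin N → ℂ → ℝ → ℝ → Vec2)
    (c s : Fin N → ℝ → ℂ) (φ : Fin m → ℝ → ℝ → Vec2) : Fin (m + N) → ℝ → ℝ → Vec2 :=
  Fin.append
    (fun j => barVec (fun i => lam (Fin.natAdd m i)) f c (lam (Fin.castAdd N j)) (φ j))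
    (newSource (fun i => lam (Fin.natAdd m i)) f c s)

end Transformation

end NLSMinus

end

/-! Let G be the matrix with columns f_j and S₋f_j, K the diagonal matrix of their parameters, A the
matrix of the forms σ with the c's added, R = A⁻¹ and Q = G R Gᵀ. Schur complements turn the
bordered determinants into ψ̄ = ψ - G R b with b = σ(g, ψ), and q̄ = q - `Q 0 0` (`barVec_eq`,
`barQ_eq`). Determinants then play no role until Δ itself is studied.

Two facts drive the computation. First, A is symmetric and KA - AK = -½ GᵀJG (`matA_commutator`), so
K can be moved through R at the price of a term in the dressed columns G R (`commutator_inverse`).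
Second, the Lax matrices are traceless, so the derivative of σ(g, h) sees only the divided
difference of the generator in the spectral parameter (`hasDerivAt_sigma`): denominators cancel, and
diagonal entries follow the same rule as the others. The Lax equations for ψ̄ thereby become 2×2
identities in Q and the moments G K R Gᵀ and G K R K Gᵀ (`dressed_vector_x`, `dressed_vector_t`).

A source acts by rank one, H(w)ψ = ½W(w, ψ)w, so all sources together act as W E v with v the vector
of pairings of sources with ψ. Such pairings solve a Sylvester equation, uniquely when the spectra
are disjoint, and the dressed pairings solve the same equation with dressed data
(`dressed_form_commutator`). Old sources therefore keep their shape. The derivative C of the c's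
adds the term G R C R b, and R b is itself the pairing of the columns of G R with ψ̄. Thus these
columns, weighted by the derivatives of the c's, are the new sources (`newSource_eq`). In the
equation for q̄ the same terms appear by completing a square in the derivative of Q (`gram_flow`),
the rest being the polynomial identity `dressed_potential_flow`.

The reduction r = -q* survives because exchanging f_j with S₋f_j turns A into minus its conjugate,
up to signs (`matA_double_submatrix`). Hence `Q 1 1` is minus the conjugate of `Q 0 0`, the new
columns come in S₋-related pairs, and Δ, of even size, is real. Finally ∂ₓ log|Δ| is the real part
of `Q 0 1`, whose derivative is qr - q̄r̄ (`gramDeriv_zero_one`). -/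

noncomputable section

namespace NLSMinus

/-! ### Matrix algebra of the dressing -/

section Algebra

/-- The symplectic matrix of the Wronskian. -/
def matJ : Matrix (Fin 2) (Fin 2) ℂ := !![0, 1; -1, 0]

def pauli1 : Matrix (Fin 2) (Fin 2) ℂ := !![0, 1; 1, 0]

def pauli3 : Matrix (Fin 2) (Fin 2) ℂ := !![1, 0; 0, -1]

/-- The off-diagonal part of `laxU`. -/
def potential (q r : ℂ) : Matrix (Fin 2) (Fin 2) ℂ := !![0, q; r, 0]

/-- The part of `laxV` that does not depend on the spectral parameter. -/
def laxVZero (q r qx rx : ℂ) : Matrix (Fin 2) (Fin 2) ℂ := !![q * r, -qx; rx, -(q * r)]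

theorem laxU_eq (μ q r : ℂ) : laxU μ q r = -(μ • pauli3) + potential q r := by
  ext i j; fin_cases i <;> fin_cases j <;> simp [laxU, pauli3, potential]

theorem laxV_eq (μ q r qx rx : ℂ) : laxV μ q r qx rx =
    Complex.I • (-((2 * μ ^ 2) • pauli3) + (2 * μ) • potential q r + laxVZero q r qx rx) := by
  ext i j
  fin_cases i <;> fin_cases j <;> simp [laxV, pauli3, potential, laxVZero] <;> ring

variable {ι S p : Type} [Fintype ι] [DecidableEq ι] [Fintype S]

/-- The Gram matrix `G R Gᵀ`. -/
def gram (G : Matrix (Fin 2) ι ℂ) (R : Matrix ι ι ℂ) : Matrix (Fin 2) (Fin 2) ℂ :=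
  G * R * Gᵀ

omit [DecidableEq ι] in
theorem gram_transpose (G : Matrix (Fin 2) ι ℂ) {R : Matrix ι ι ℂ} (hR : Rᵀ = R) :
    (gram G R)ᵀ = gram G R := by
  simp [gram, Matrix.transpose_mul, hR, Matrix.mul_assoc]

theorem transpose_of_fin_two (a b c d : ℂ) : (!![a, b; c, d])ᵀ = !![a, c; b, d] := by
  ext i j; fin_cases i <;> fin_cases j <;> rfl

theorem exists_eq_of_eta (M : Matrix (Fin 2) (Fin 2) ℂ) :
    ∃ a b c d, M = !![a, b; c, d] :=
  ⟨_, _, _, _, Matrix.eta_fin_two M⟩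

theorem exists_eq_of_transpose_eq {Q : Matrix (Fin 2) (Fin 2) ℂ} (hQ : Qᵀ = Q) :
    ∃ a b d, Q = !![a, b; b, d] := by
  refine ⟨Q 0 0, Q 0 1, Q 1 1, ?_⟩
  have h : Q 1 0 = Q 0 1 := congrFun (congrFun hQ 0) 1
  conv_lhs => rw [Matrix.eta_fin_two Q, h]

/-- The two corrections have different origins: `pauli3 * Q * matJ` comes from moving the parameters
through the inverse of A, `Q * pauli1` from differentiating that inverse. For symmetric Q their sum
is off-diagonal, so the dressed spectral problem is again of AKNS form. -/
theorem dressed_potential (q r : ℂ) (Q : Matrix (Fin 2) (Fin 2) ℂ) (hQ : Qᵀ = Q) :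
    potential (q - Q 0 0) (r - Q 1 1) =
      potential q r - (1 / 2 : ℂ) • (pauli3 * Q * matJ) - (1 / 2 : ℂ) • (Q * pauli1) := by
  obtain ⟨a, b, d, rfl⟩ := exists_eq_of_transpose_eq hQ
  ext i j
  fin_cases i <;> fin_cases j <;> simp [potential, pauli1, pauli3, matJ] <;> ring

variable {G : Matrix (Fin 2) ι ℂ} {A R K : Matrix ι ι ℂ}

/-- Conjugation of the Sylvester relation for A by its inverse. This is the only rewriting rule
needed to bring every word in K and R to normal form. -/
theorem commutator_inverse (hAR : A * R = 1) (hRA : R * A = 1)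
    (hK : K * A - A * K = -((1 / 2 : ℂ) • (Gᵀ * matJ * G))) :
    K * R = R * K + (1 / 2 : ℂ) • (R * (Gᵀ * (matJ * (G * R)))) := by
  have h1 : R * (K * A - A * K) * R = R * K - K * R := by
    rw [Matrix.mul_sub, Matrix.sub_mul, ← Matrix.mul_assoc R A K, hRA, Matrix.mul_assoc,
      Matrix.mul_assoc, hAR, Matrix.one_mul, Matrix.mul_one]
  rw [hK] at h1
  simp only [Matrix.mul_neg, Matrix.neg_mul, Matrix.mul_smul, Matrix.smul_mul,
    Matrix.mul_assoc] at h1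
  rw [← sub_eq_iff_eq_add', ← neg_sub, ← h1, neg_neg]

/-- The dressed columns `G R` solve the spatial equation with the dressed potential. -/
theorem dressed_columns_x (hAR : A * R = 1) (hRA : R * A = 1) (hR : Rᵀ = R)
    (hK : K * A - A * K = -((1 / 2 : ℂ) • (Gᵀ * matJ * G))) (q r : ℂ) :
    (-(pauli3 * G * K) + potential q r * G) * R
        + G * -(R * ((1 / 2 : ℂ) • (Gᵀ * pauli1 * G)) * R) =
      -(pauli3 * (G * R) * K)
        + potential (q - gram G R 0 0) (r - gram G R 1 1) * (G * R) := by
  rw [dressed_potential q r _ (gram_transpose G hR)]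
  simp only [gram, Matrix.add_mul, Matrix.sub_mul, Matrix.mul_add, Matrix.neg_mul,
    Matrix.mul_neg, Matrix.smul_mul, Matrix.mul_smul, Matrix.mul_assoc,
    commutator_inverse hAR hRA hK]
  module

/-- Action of the parameters on the coordinates `y = R b` of a dressed vector. -/
theorem commutator_coords (hAR : A * R = 1) (hRA : R * A = 1) (hR : Rᵀ = R)
    (hK : K * A - A * K = -((1 / 2 : ℂ) • (Gᵀ * matJ * G)))
    {ψ : Matrix (Fin 2) p ℂ} {b : Matrix ι p ℂ} {z : ℂ}
    (hb : K * b - z • b = -((1 / 2 : ℂ) • (Gᵀ * matJ * ψ))) :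
    K * (R * b) = z • (R * b) - (1 / 2 : ℂ) • ((G * R)ᵀ * (matJ * (ψ - G * (R * b)))) := by
  have hb' : K * b = z • b - (1 / 2 : ℂ) • (Gᵀ * (matJ * ψ)) := by
    rw [sub_eq_iff_eq_add] at hb
    rw [hb, Matrix.mul_assoc]; abel
  rw [← Matrix.mul_assoc K R b, commutator_inverse hAR hRA hK]
  simp only [Matrix.transpose_mul, hR, Matrix.add_mul, Matrix.mul_sub, Matrix.smul_mul,
    Matrix.mul_smul, Matrix.mul_assoc, hb']
  module

/-- A dressed vector solves the spatial equation with the dressed potential. -/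
theorem dressed_vector_x (hAR : A * R = 1) (hRA : R * A = 1) (hR : Rᵀ = R)
    (hK : K * A - A * K = -((1 / 2 : ℂ) • (Gᵀ * matJ * G))) (q r : ℂ)
    {ψ : Matrix (Fin 2) p ℂ} {b : Matrix ι p ℂ} {z : ℂ}
    (hb : K * b - z • b = -((1 / 2 : ℂ) • (Gᵀ * matJ * ψ))) :
    (-(z • pauli3) + potential q r) * ψ
        - (((-(pauli3 * G * K) + potential q r * G) * R
          + G * -(R * ((1 / 2 : ℂ) • (Gᵀ * pauli1 * G)) * R)) * b
          + G * R * ((1 / 2 : ℂ) • (Gᵀ * pauli1 * ψ))) =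
      (-(z • pauli3) + potential (q - gram G R 0 0) (r - gram G R 1 1))
        * (ψ - G * R * b) := by
  have hb' : K * b = z • b - (1 / 2 : ℂ) • (Gᵀ * (matJ * ψ)) := by
    rw [sub_eq_iff_eq_add] at hb
    rw [hb, Matrix.mul_assoc]; abel
  rw [dressed_columns_x hAR hRA hR hK, dressed_potential q r _ (gram_transpose G hR)]
  simp only [gram, Matrix.add_mul, Matrix.sub_mul, Matrix.mul_sub,
    Matrix.neg_mul, Matrix.smul_mul, Matrix.mul_smul, Matrix.mul_assoc, hb']
  module

/-- The spatial derivative of the Gram matrix, in terms of `M = G K R Gᵀ`. -/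
def gramDeriv (q r : ℂ) (Q M : Matrix (Fin 2) (Fin 2) ℂ) : Matrix (Fin 2) (Fin 2) ℂ :=
  -(pauli3 * M) - Mᵀ * pauli3 + potential q r * Q + Q * (potential q r)ᵀ
    - (1 / 2 : ℂ) • (Q * pauli1 * Q)

/-- The hypothesis on `Mᵀ` is the relation of `moment_transpose`; only its off-diagonal entry
carries information, and it enters the diagonal entries of the identity. -/
theorem dressed_laxVZero (q r qx rx : ℂ) (Q M : Matrix (Fin 2) (Fin 2) ℂ) (hQ : Qᵀ = Q)
    (hM : Mᵀ = M - (1 / 2 : ℂ) • (Q * matJ * Q)) :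
    laxVZero (q - Q 0 0) (r - Q 1 1)
        (qx - gramDeriv q r Q M 0 0) (rx - gramDeriv q r Q M 1 1) =
      laxVZero q r qx rx - pauli3 * M * matJ - Mᵀ * pauli1 + potential q r * Q * matJ
        - Q * matJ * potential q r - (1 / 2 : ℂ) • (Q * pauli1 * Q * matJ) := by
  obtain ⟨a, b, d, rfl⟩ := exists_eq_of_transpose_eq hQ
  obtain ⟨m₁, m₂, m₃, m₄, rfl⟩ := exists_eq_of_eta M
  have h := congrFun (congrFun hM 0) 1
  simp [matJ] at h
  ext i j
  fin_cases i <;> fin_cases j <;>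
    simp [potential, pauli1, pauli3, matJ, laxVZero, gramDeriv, transpose_of_fin_two]
  · linear_combination h
  · ring
  · ring
  · linear_combination -h

/-- The second spatial derivative of the Gram matrix, in terms of `M = G K R Gᵀ` and
`M₂ = G K R K Gᵀ`. -/
def gramDeriv2 (q r qx rx : ℂ) (Q M M₂ : Matrix (Fin 2) (Fin 2) ℂ) :
    Matrix (Fin 2) (Fin 2) ℂ :=
  let M' := -(pauli3 * (M₂ + (1 / 2 : ℂ) • (M * matJ * Q))) + potential q r * M
    - (1 / 2 : ℂ) • (M * pauli1 * Q) - M₂ * pauli3 + M * (potential q r)ᵀ;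
  let Q' := gramDeriv q r Q M;
  -(pauli3 * M') - M'ᵀ * pauli3 + (potential qx rx * Q + potential q r * Q')
    + (Q' * (potential q r)ᵀ + Q * (potential qx rx)ᵀ)
    - (1 / 2 : ℂ) • (Q' * pauli1 * Q + Q * pauli1 * Q')

/-- The source-free part of the time derivative of the Gram matrix. -/
def gramFlow (q r qx rx : ℂ) (Q M M₂ : Matrix (Fin 2) (Fin 2) ℂ) :
    Matrix (Fin 2) (Fin 2) ℂ :=
  let N := M₂ + (1 / 2 : ℂ) • (M * matJ * Q);
  -((2 : ℂ) • (pauli3 * N)) - (2 : ℂ) • (Nᵀ * pauli3) + (2 : ℂ) • (potential q r * M)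
    + (2 : ℂ) • (Mᵀ * (potential q r)ᵀ) + laxVZero q r qx rx * Q + Q * (laxVZero q r qx rx)ᵀ
    - (Mᵀ * pauli1 * Q + Q * pauli1 * M + Q * matJ * potential q r * Q)

/-- The dressed potential satisfies the evolution equation up to sources. -/
theorem dressed_potential_flow (q r qx rx qxx : ℂ) (Q M M₂ : Matrix (Fin 2) (Fin 2) ℂ)
    (hQ : Qᵀ = Q) (hM : Mᵀ = M - (1 / 2 : ℂ) • (Q * matJ * Q)) (hM₂ : M₂ᵀ = M₂) :
    2 * (q - Q 0 0) ^ 2 * (r - Q 1 1) - (qxx - gramDeriv2 q r qx rx Q M M₂ 0 0) =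
      2 * q ^ 2 * r - qxx - gramFlow q r qx rx Q M M₂ 0 0 := by
  obtain ⟨a, b, d, rfl⟩ := exists_eq_of_transpose_eq hQ
  obtain ⟨a', b', d', rfl⟩ := exists_eq_of_transpose_eq hM₂
  obtain ⟨m₁, m₂, m₃, m₄, rfl⟩ := exists_eq_of_eta M
  have h := congrFun (congrFun hM 0) 1
  simp [matJ] at h
  simp [potential, pauli1, pauli3, matJ, laxVZero, gramDeriv, gramDeriv2, gramFlow,
    transpose_of_fin_two]
  -- The relation between M and its transpose has one independent entry; once it is eliminated, the
  -- identity is polynomial in free variables.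
  obtain rfl : m₃ = m₂ - 2⁻¹ * (-(b * b) + a * d) := h
  ring

theorem moment_transpose (hAR : A * R = 1) (hRA : R * A = 1) (hR : Rᵀ = R) (hKt : Kᵀ = K)
    (hK : K * A - A * K = -((1 / 2 : ℂ) • (Gᵀ * matJ * G))) :
    (G * K * R * Gᵀ)ᵀ = G * K * R * Gᵀ - (1 / 2 : ℂ) • (gram G R * matJ * gram G R) := by
  simp only [gram, Matrix.transpose_mul, Matrix.transpose_transpose, hR, hKt, Matrix.mul_assoc]
  rw [← Matrix.mul_assoc K R Gᵀ, commutator_inverse hAR hRA hK]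
  simp only [Matrix.add_mul, Matrix.mul_add, Matrix.smul_mul, Matrix.mul_smul, Matrix.mul_assoc]
  module

/-- The time derivative of the columns `G`. -/
def columnsFlow (q r qx rx : ℂ) (G : Matrix (Fin 2) ι ℂ) (K : Matrix ι ι ℂ)
    (W : Matrix (Fin 2) S ℂ) (E : Matrix S S ℂ) (B : Matrix ι S ℂ) : Matrix (Fin 2) ι ℂ :=
  Complex.I • (-((2 : ℂ) • (pauli3 * G * K * K)) + (2 : ℂ) • (potential q r * G * K)
    + laxVZero q r qx rx * G) + W * E * Bᵀ

/-- The time derivative of the matrix `A`. -/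
def matAFlow (q r : ℂ) (G : Matrix (Fin 2) ι ℂ) (K C : Matrix ι ι ℂ)
    (E : Matrix S S ℂ) (B : Matrix ι S ℂ) : Matrix ι ι ℂ :=
  C + Complex.I • (K * Gᵀ * pauli1 * G + Gᵀ * pauli1 * G * K + Gᵀ * matJ * potential q r * G)
    + B * E * Bᵀ

/-- The source terms complete a square: differentiating G, R and Gᵀ gives W E BᵀRGᵀ, its transpose
and -GRB E BᵀRGᵀ, which is the difference of the undressed and dressed quadratic forms in E. -/
theorem gram_flow (hAR : A * R = 1) (hRA : R * A = 1) (hR : Rᵀ = R) (hKt : Kᵀ = K)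
    (hK : K * A - A * K = -((1 / 2 : ℂ) • (Gᵀ * matJ * G))) (q r qx rx : ℂ)
    (C : Matrix ι ι ℂ) (W : Matrix (Fin 2) S ℂ) {E : Matrix S S ℂ} (hE : Eᵀ = E)
    (B : Matrix ι S ℂ) :
    (columnsFlow q r qx rx G K W E B * R + G * -(R * matAFlow q r G K C E B * R)) * Gᵀ
        + G * R * (columnsFlow q r qx rx G K W E B)ᵀ =
      Complex.I • gramFlow q r qx rx (gram G R) (G * K * R * Gᵀ) (G * K * R * K * Gᵀ)
        + W * E * Wᵀ - (W - G * R * B) * E * (W - G * R * B)ᵀ - G * R * C * (G * R)ᵀ := by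
  have h3 : pauli3ᵀ = pauli3 := by
    ext i j; fin_cases i <;> fin_cases j <;> simp [pauli3]
  have hN : G * K * R * K * Gᵀ + (1 / 2 : ℂ) • (G * K * R * Gᵀ * matJ * gram G R)
      = G * K * K * R * Gᵀ := by
    simp only [gram, Matrix.mul_assoc]
    rw [← Matrix.mul_assoc K R Gᵀ, commutator_inverse hAR hRA hK]
    simp only [Matrix.add_mul, Matrix.mul_add, Matrix.smul_mul, Matrix.mul_smul,
      Matrix.mul_assoc]
  simp only [gramFlow, hN]
  simp only [gram, columnsFlow, matAFlow, Matrix.transpose_add, Matrix.transpose_sub,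
    Matrix.transpose_neg, Matrix.transpose_smul, Matrix.transpose_mul,
    Matrix.transpose_transpose, hR, hKt, hE, h3, Matrix.add_mul, Matrix.sub_mul,
    Matrix.mul_add, Matrix.mul_sub, Matrix.neg_mul, Matrix.mul_neg, Matrix.smul_mul,
    Matrix.mul_smul, Matrix.mul_assoc]
  module

/-- A dressed vector solves the temporal equation with the dressed potential and sources. -/
theorem dressed_vector_t (hAR : A * R = 1) (hRA : R * A = 1) (hR : Rᵀ = R) (hKt : Kᵀ = K)
    (hK : K * A - A * K = -((1 / 2 : ℂ) • (Gᵀ * matJ * G))) (q r qx rx : ℂ)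
    (C : Matrix ι ι ℂ) (W : Matrix (Fin 2) S ℂ) {E : Matrix S S ℂ}
    (B : Matrix ι S ℂ) {ψ : Matrix (Fin 2) p ℂ} {b : Matrix ι p ℂ} (v : Matrix S p ℂ) {z : ℂ}
    (hb : K * b - z • b = -((1 / 2 : ℂ) • (Gᵀ * matJ * ψ))) :
    Complex.I • ((-((2 * z ^ 2) • pauli3) + (2 * z) • potential q r + laxVZero q r qx rx) * ψ)
          + W * E * v
        - ((columnsFlow q r qx rx G K W E B * R + G * -(R * matAFlow q r G K C E B * R)) * b
          + G * R * (Complex.I • (K * Gᵀ * pauli1 * ψ + z • (Gᵀ * pauli1 * ψ)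
              + Gᵀ * matJ * potential q r * ψ) + B * E * v)) =
      Complex.I • ((-((2 * z ^ 2) • pauli3)
          + (2 * z) • potential (q - gram G R 0 0) (r - gram G R 1 1)
          + laxVZero (q - gram G R 0 0) (r - gram G R 1 1)
            (qx - gramDeriv q r (gram G R) (G * K * R * Gᵀ) 0 0)
            (rx - gramDeriv q r (gram G R) (G * K * R * Gᵀ) 1 1)) * (ψ - G * R * b))
        + (W - G * R * B) * E * (v - Bᵀ * R * b) + G * R * C * (R * b) := by
  rw [dressed_laxVZero q r qx rx _ _ (gram_transpose G hR)
      (moment_transpose hAR hRA hR hKt hK),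
    dressed_potential q r _ (gram_transpose G hR)]
  have h1 := commutator_coords hAR hRA hR hK hb
  simp only [Matrix.transpose_mul, hR, Matrix.mul_assoc] at h1
  simp only [gram, columnsFlow, matAFlow, Matrix.transpose_mul,
    Matrix.transpose_transpose, hR, hKt, Matrix.add_mul, Matrix.sub_mul,
    Matrix.mul_add, Matrix.mul_sub, Matrix.neg_mul, Matrix.mul_neg, Matrix.smul_mul,
    Matrix.mul_smul, Matrix.mul_assoc, h1]
  module

end Algebra

/-! ### Entrywise calculus of matrix curves -/

section MatrixDerivatives

variable {n : Type} [Fintype n] [DecidableEq n]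

/-- Entrywise derivative of a curve of matrices. -/
def HasEntryDerivAt {m n : Type} (M : ℝ → Matrix m n ℂ) (M' : Matrix m n ℂ) (s : ℝ) : Prop :=
  ∀ i j, HasDerivAt (fun τ => M τ i j) (M' i j) s

theorem HasEntryDerivAt.congr_deriv {m n : Type} {M : ℝ → Matrix m n ℂ} {M' M'' : Matrix m n ℂ}
    {s : ℝ} (h : HasEntryDerivAt M M' s) (e : M' = M'') : HasEntryDerivAt M M'' s := e ▸ h

theorem HasEntryDerivAt.unique {m n : Type} {M : ℝ → Matrix m n ℂ} {M' M'' : Matrix m n ℂ}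
    {s : ℝ} (h : HasEntryDerivAt M M' s) (h' : HasEntryDerivAt M M'' s) : M' = M'' := by
  ext i j; exact (h i j).unique (h' i j)

theorem HasEntryDerivAt.congr_of_eventuallyEq {m n : Type} {M N : ℝ → Matrix m n ℂ}
    {M' : Matrix m n ℂ} {s : ℝ} (h : HasEntryDerivAt M M' s) (e : N =ᶠ[𝓝 s] M) :
    HasEntryDerivAt N M' s := fun i j =>
  (h i j).congr_of_eventuallyEq (e.mono fun _ hτ => congrFun (congrFun hτ i) j)

theorem hasEntryDerivAt_const {m n : Type} (M : Matrix m n ℂ) (s : ℝ) :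
    HasEntryDerivAt (fun _ => M) 0 s := fun _ _ => hasDerivAt_const _ _

theorem HasEntryDerivAt.mul {l m n : Type} [Fintype m] {M : ℝ → Matrix l m ℂ}
    {N : ℝ → Matrix m n ℂ} {M' : Matrix l m ℂ}
    {N' : Matrix m n ℂ} {s : ℝ} (hM : HasEntryDerivAt M M' s) (hN : HasEntryDerivAt N N' s) :
    HasEntryDerivAt (fun τ => M τ * N τ) (M' * N s + M s * N') s := fun i j => by
  simp only [Matrix.mul_apply, Matrix.add_apply, ← Finset.sum_add_distrib]
  exact HasDerivAt.fun_sum fun k _ => (hM i k).mul (hN k j)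

theorem HasEntryDerivAt.const_mul {l m n : Type} [Fintype m] (M : Matrix l m ℂ)
    {N : ℝ → Matrix m n ℂ} {N' : Matrix m n ℂ} {s : ℝ} (hN : HasEntryDerivAt N N' s) :
    HasEntryDerivAt (fun τ => M * N τ) (M * N') s :=
  ((hasEntryDerivAt_const M s).mul hN).congr_deriv (by simp)

theorem HasEntryDerivAt.mul_const {l m n : Type} [Fintype m] {M : ℝ → Matrix l m ℂ}
    {M' : Matrix l m ℂ} {s : ℝ} (hM : HasEntryDerivAt M M' s) (N : Matrix m n ℂ) :
    HasEntryDerivAt (fun τ => M τ * N) (M' * N) s :=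
  (hM.mul (hasEntryDerivAt_const N s)).congr_deriv (by simp)

theorem HasEntryDerivAt.transpose {m n : Type} {M : ℝ → Matrix m n ℂ} {M' : Matrix m n ℂ}
    {s : ℝ} (hM : HasEntryDerivAt M M' s) : HasEntryDerivAt (fun τ => (M τ)ᵀ) M'ᵀ s :=
  fun i j => hM j i

theorem HasEntryDerivAt.add {m n : Type} {M N : ℝ → Matrix m n ℂ} {M' N' : Matrix m n ℂ}
    {s : ℝ} (hM : HasEntryDerivAt M M' s) (hN : HasEntryDerivAt N N' s) :
    HasEntryDerivAt (fun τ => M τ + N τ) (M' + N') s := fun i j => (hM i j).add (hN i j)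

theorem HasEntryDerivAt.sub {m n : Type} {M N : ℝ → Matrix m n ℂ} {M' N' : Matrix m n ℂ}
    {s : ℝ} (hM : HasEntryDerivAt M M' s) (hN : HasEntryDerivAt N N' s) :
    HasEntryDerivAt (fun τ => M τ - N τ) (M' - N') s := fun i j => (hM i j).sub (hN i j)

theorem HasEntryDerivAt.neg {m n : Type} {M : ℝ → Matrix m n ℂ} {M' : Matrix m n ℂ}
    {s : ℝ} (hM : HasEntryDerivAt M M' s) :
    HasEntryDerivAt (fun τ => -M τ) (-M') s := fun i j => (hM i j).neg

theorem HasEntryDerivAt.const_smul {m n : Type} {M : ℝ → Matrix m n ℂ} {M' : Matrix m n ℂ}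
    {s : ℝ} (a : ℂ) (hM : HasEntryDerivAt M M' s) :
    HasEntryDerivAt (fun τ => a • M τ) (a • M') s := fun i j => (hM i j).const_mul a

theorem det_updateCol_eq_sum (A : Matrix n n ℂ) (j : n) (v : n → ℂ) :
    (A.updateCol j v).det = ∑ i, A.adjugate j i * v i := by
  rw [← Matrix.cramer_apply, Matrix.cramer_eq_adjugate_mulVec, Matrix.mulVec, dotProduct]

/-- Jacobi's formula. -/
theorem HasEntryDerivAt.det {A : ℝ → Matrix n n ℂ} {A' : Matrix n n ℂ} {s : ℝ}
    (hA : HasEntryDerivAt A A' s) :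
    HasDerivAt (fun τ => (A τ).det) ((A s).adjugate * A').trace s := by
  have h : (((A s).adjugate * A').trace) =
      ∑ σ : Equiv.Perm n, ((Equiv.Perm.sign σ : ℤ) : ℂ) *
        ∑ i, (∏ j ∈ Finset.univ.erase i, A s (σ j) j) • A' (σ i) i := by
    simp only [Matrix.trace, Matrix.diag, Matrix.mul_apply]
    simp_rw [← det_updateCol_eq_sum, Matrix.det_apply', Finset.mul_sum]
    rw [Finset.sum_comm]
    refine Finset.sum_congr rfl fun σ _ => Finset.sum_congr rfl fun i _ => ?_
    rw [← Finset.prod_erase_mul _ _ (Finset.mem_univ i), Matrix.updateCol_self, smul_eq_mul]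
    congr 2
    exact Finset.prod_congr rfl fun j hj =>
      Matrix.updateCol_ne (Finset.ne_of_mem_erase hj)
  rw [h]
  simp_rw [Matrix.det_apply']
  exact HasDerivAt.fun_sum fun σ _ =>
    (HasDerivAt.fun_finsetProd fun i _ => hA (σ i) i).const_mul _

/-- Cramer's rule gives differentiability of the inverse, and differentiating `A * A⁻¹ = 1`, valid
near `s`, then gives the value. -/
theorem HasEntryDerivAt.inv {A : ℝ → Matrix n n ℂ} {A' : Matrix n n ℂ} {s : ℝ}
    (hA : HasEntryDerivAt A A' s) (hdet : (A s).det ≠ 0) :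
    HasEntryDerivAt (fun τ => (A τ)⁻¹) (-((A s)⁻¹ * A' * (A s)⁻¹)) s := by
  have hadj : ∀ i j, ∃ d, HasDerivAt (fun τ => (A τ)⁻¹ i j) d s := fun i j => by
    have h1 : HasEntryDerivAt (fun τ => (A τ).updateRow j (Pi.single i 1))
        (A'.updateRow j 0) s := fun k l => by
      by_cases hk : k = j
      · subst hk; simpa using hasDerivAt_const s _
      · simpa [Matrix.updateRow_ne hk] using hA k l
    refine ⟨_, ((hA.det.inv hdet).mul h1.det).congr_of_eventuallyEq
      (Filter.Eventually.of_forall fun τ => ?_)⟩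
    simp [Matrix.inv_def, Matrix.adjugate_apply]
  choose d hd using hadj
  have hR : HasEntryDerivAt (fun τ => (A τ)⁻¹) (Matrix.of d) s := hd
  have hunit : IsUnit (A s).det := isUnit_iff_ne_zero.2 hdet
  have h1 := (hasEntryDerivAt_const (1 : Matrix n n ℂ) s).congr_of_eventuallyEq
    (N := fun τ => A τ * (A τ)⁻¹) (by
      filter_upwards [hA.det.continuousAt.eventually_ne hdet] with τ hτ
      exact Matrix.mul_nonsing_inv _ (isUnit_iff_ne_zero.2 hτ))
  have h2 := (hA.mul hR).unique h1
  refine hR.congr_deriv ?_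
  have h3 := congrArg (fun X => (A s)⁻¹ * X) (eq_neg_of_add_eq_zero_right h2)
  simpa only [← Matrix.mul_assoc, Matrix.nonsing_inv_mul _ hunit, Matrix.one_mul,
    Matrix.mul_neg] using h3

end MatrixDerivatives

/-- Exchange of a complex and a real derivative. -/
theorem hasDerivAt_deriv_of_contDiffAt {E : Type*} [NormedAddCommGroup E] [NormedSpace ℂ E]
    [CompleteSpace E] {f : ℂ → ℝ → E} {f' : ℂ → E} {D : Set ℂ} {s₀ : ℝ} {μ : ℂ} (hD : IsOpen D)
    (hμ : μ ∈ D) (hcont : ∀ z ∈ D, ContDiffAt ℝ 1 (fun p : ℂ × ℝ => f p.1 p.2) (z, s₀))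
    (hhol : ∀ᶠ s in 𝓝 s₀, DifferentiableOn ℂ (fun z => f z s) D)
    (hf' : ∀ z ∈ D, HasDerivAt (f z) (f' z) s₀) :
    HasDerivAt (fun s => deriv (fun z => f z s) μ) (deriv f' μ) s₀ := by
  -- Joint C¹ regularity gives strict differentiability, which keeps all difference quotients near
  -- z₀ close to the single vector `L (0, 1)`. A locally uniform limit of holomorphic functions may
  -- be differentiated, which concludes.
  have hlim : TendstoLocallyUniformlyOn (fun s z => slope (f z) s₀ s) f' (𝓝[≠] s₀) D := by
    rw [Metric.tendstoLocallyUniformlyOn_iff]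
    intro ε hε z₀ hz₀
    obtain ⟨L, hL⟩ : ∃ L, HasStrictFDerivAt (fun p : ℂ × ℝ => f p.1 p.2) L (z₀, s₀) :=
      ⟨_, (hcont z₀ hz₀).hasStrictFDerivAt one_ne_zero⟩
    have h1 := hL.isLittleO.def (by positivity : 0 < ε / 3)
    have hcomp : Filter.Tendsto (fun p : ℂ × ℝ => ((p.1, p.2), (p.1, s₀))) (𝓝 (z₀, s₀))
        (𝓝 ((z₀, s₀), (z₀, s₀))) := by
      apply Continuous.tendsto'
      · fun_prop
      · rfl
    have h2 := hcomp.eventually h1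
    rw [nhds_prod_eq, Filter.eventually_prod_iff] at h2
    obtain ⟨pz, hpz, ps, hps, h3⟩ := h2
    have h4 : ∀ z, pz z → ∀ s, ps s → s ≠ s₀ → ‖slope (f z) s₀ s - L (0, 1)‖ ≤ ε / 3 := by
      intro z hz s hs hne
      have h5 := h3 hz hs
      have h6 : L ((z, s) - (z, s₀)) = (s - s₀) • L (0, 1) := by
        rw [← map_smul]; simp
      have h7 : ‖((z, s) - (z, s₀) : ℂ × ℝ)‖ = ‖s - s₀‖ := by
        simp [Prod.norm_def]
      simp only [h6, h7] at h5
      have hpos : 0 < ‖s - s₀‖ := norm_pos_iff.2 (sub_ne_zero.2 hne)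
      have h8 : slope (f z) s₀ s - L (0, 1) =
          (s - s₀)⁻¹ • (f z s - f z s₀ - (s - s₀) • L (0, 1)) := by
        rw [slope_def_module, smul_sub _ (f z s - f z s₀), inv_smul_smul₀ (sub_ne_zero.2 hne)]
      rw [h8, norm_smul, norm_inv, inv_mul_le_iff₀ hpos, mul_comm]
      exact h5
    have hps' : ∀ᶠ s in 𝓝[≠] s₀, ps s ∧ s ≠ s₀ :=
      (hps.filter_mono nhdsWithin_le_nhds).and self_mem_nhdsWithin
    refine ⟨{z | pz z} ∩ D, Filter.inter_mem (mem_nhdsWithin_of_mem_nhds hpz)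
      self_mem_nhdsWithin, ?_⟩
    filter_upwards [hps'] with s hs z hz
    -- Passing to the limit in `h4` places `f' z` near the same vector, so continuity of `f'` is not
    -- needed.
    have h9 : ‖f' z - L (0, 1)‖ ≤ ε / 3 :=
      le_of_tendsto (((hasDerivAt_iff_tendsto_slope.1 (hf' z hz.2)).sub_const _).norm)
        (hps'.mono fun s' hs' => h4 z hz.1 s' hs'.1 hs'.2)
    have h10 := h4 z hz.1 s hs.1 hs.2
    rw [dist_eq_norm]
    have h11 : f' z - slope (f z) s₀ s = (f' z - L (0, 1)) - (slope (f z) s₀ s - L (0, 1)) := by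
      abel
    rw [h11]
    have := norm_sub_le (f' z - L (0, 1)) (slope (f z) s₀ s - L (0, 1))
    linarith
  have hhol₀ := hhol.self_of_nhds
  have hslope : ∀ᶠ s in 𝓝[≠] s₀, DifferentiableOn ℂ (fun z => slope (f z) s₀ s) D := by
    filter_upwards [hhol.filter_mono nhdsWithin_le_nhds] with s hs
    simp only [slope_def_module]
    exact (hs.sub hhol₀).const_smul _
  rw [hasDerivAt_iff_tendsto_slope]
  refine ((hlim.deriv hslope hD).tendsto_at hμ).congr' ?_
  filter_upwards [hhol.filter_mono nhdsWithin_le_nhds] with s hs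
  have hd : DifferentiableAt ℂ (fun z => f z s) μ := hs.differentiableAt (hD.mem_nhds hμ)
  have hd₀ : DifferentiableAt ℂ (fun z => f z s₀) μ := hhol₀.differentiableAt (hD.mem_nhds hμ)
  simp only [Function.comp_apply, slope_def_module]
  have := ((hd.hasDerivAt.sub hd₀.hasDerivAt).const_smul ((s - s₀)⁻¹)).deriv
  exact this

/-! ### Wronskians and the derivative of σ -/

section Wronskian

theorem wronskian_self (g : Vec2) : wronskian g g = 0 := by
  simp [wronskian, mul_comm]

theorem wronskian_comm (g h : Vec2) : wronskian g h = -wronskian h g := by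
  simp [wronskian]; ring

/-- Traceless 2×2 matrices are infinitesimally symplectic. -/
theorem wronskian_mulVec_left {N : Matrix (Fin 2) (Fin 2) ℂ} (hN : N.trace = 0) (g h : Vec2) :
    wronskian (N *ᵥ g) h = -wronskian g (N *ᵥ h) := by
  rw [Matrix.trace_fin_two] at hN
  simp [wronskian, Matrix.mulVec, dotProduct, Fin.sum_univ_two]
  linear_combination (g 0 * h 1 - g 1 * h 0) * hN

theorem hasDerivAt_wronskian {g h : ℝ → Vec2} {g' h' : Vec2} {s : ℝ} (hg : HasDerivAt g g' s)
    (hh : HasDerivAt h h' s) :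
    HasDerivAt (fun τ => wronskian (g τ) (h τ)) (wronskian g' (h s) + wronskian (g s) h') s := by
  rw [hasDerivAt_pi] at hg hh
  refine (((hg 0).mul (hh 1)).sub ((hg 1).mul (hh 0))).congr_deriv ?_
  simp only [wronskian]; ring

theorem wronskian_sub_right (g h k : Vec2) :
    wronskian g (h - k) = wronskian g h - wronskian g k := by
  simp [wronskian]; ring

/-- The source matrix has rank one, so a source acts through its Wronskian with the vector; this
turns source sums into Cauchy matrices. -/
theorem sourceH_mulVec (w h : Vec2) : sourceH w *ᵥ h = ((1 / 2) * wronskian w h) • w := by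
  ext k
  fin_cases k <;>
    simp [sourceH, wronskian, Matrix.mulVec, dotProduct, Fin.sum_univ_two] <;> ring

theorem sigma_of_ne {g h : SpectralVector} (hne : g.param ≠ h.param) :
    sigma g h = -wronskian g.value h.value / (2 * (g.param - h.param)) := by
  simp [sigma, hne]

theorem sigma_of_eq {g h : SpectralVector} (he : g.param = h.param) :
    sigma g h = wronskian g.value (deriv h.family g.param) / 2 := by
  simp [sigma, he]

/-- The derivative of `σ(g, h)` along a linear flow with generators `Nμ`, `Nν` at the two
parameters, `D` being their divided difference. -/
theorem hasDerivAt_sigma {μ ν : ℂ} {g h : ℂ → ℝ → Vec2} {Nμ Nν D : Matrix (Fin 2) (Fin 2) ℂ}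
    {s : ℝ} (hg : HasDerivAt (g μ) (Nμ *ᵥ g μ s) s) (hh : HasDerivAt (h ν) (Nν *ᵥ h ν s) s)
    (htr : Nμ.trace = 0) (hD : Nν - Nμ = (μ - ν) • D)
    (hdiag : μ = ν → HasDerivAt (fun τ => deriv (fun z => h z τ) μ)
      (Nμ *ᵥ deriv (fun z => h z s) μ - D *ᵥ h ν s) s) :
    HasDerivAt (fun τ => sigma ⟨μ, fun z => g z τ⟩ ⟨ν, fun z => h z τ⟩)
      (-(1 / 2) * wronskian (g μ s) (D *ᵥ h ν s)) s := by
  by_cases hμν : μ = ν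
  · have h1 : (fun τ => sigma ⟨μ, fun z => g z τ⟩ ⟨ν, fun z => h z τ⟩) =
        fun τ => wronskian (g μ τ) (deriv (fun z => h z τ) μ) / 2 :=
      funext fun τ => sigma_of_eq hμν
    rw [h1]
    refine ((hasDerivAt_wronskian hg (hdiag hμν)).div_const 2).congr_deriv ?_
    rw [wronskian_mulVec_left htr, wronskian_sub_right]
    ring
  · have h1 : (fun τ => sigma ⟨μ, fun z => g z τ⟩ ⟨ν, fun z => h z τ⟩) =
        fun τ => -wronskian (g μ τ) (h ν τ) / (2 * (μ - ν)) :=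
      funext fun τ => sigma_of_ne hμν
    rw [h1]
    refine ((hasDerivAt_wronskian hg hh).neg.div_const (2 * (μ - ν))).congr_deriv ?_
    have h2 : Nν = Nμ + (μ - ν) • D := by rw [← hD]; abel
    have h3 : μ - ν ≠ 0 := sub_ne_zero.2 hμν
    rw [wronskian_mulVec_left htr, h2, Matrix.add_mulVec, Matrix.smul_mulVec]
    simp only [wronskian, Pi.add_apply, Pi.smul_apply, smul_eq_mul]
    field_simp
    ring

theorem laxU_trace (z q r : ℂ) : (laxU z q r).trace = 0 := by
  simp [laxU, Matrix.trace_fin_two]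

theorem laxU_sub (μ ν q r : ℂ) : laxU ν q r - laxU μ q r = (μ - ν) • pauli3 := by
  rw [laxU_eq, laxU_eq, sub_smul]; abel

end Wronskian

/-! ### The temporal Lax matrix and its divided difference -/

section Temporal

variable {S : Type} [Fintype S]

/-- The temporal Lax matrix with sources `w k` of weight `e k` at the parameters `ζ k`. -/
def laxT (e ζ : S → ℂ) (w : S → Vec2) (q r qx rx z : ℂ) : Matrix (Fin 2) (Fin 2) ℂ :=
  laxV z q r qx rx + ∑ k, (e k / (z - ζ k)) • sourceH (w k)

/-- The divided difference of `laxT`. -/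
def laxTDiff (e ζ : S → ℂ) (w : S → Vec2) (q r μ ν : ℂ) : Matrix (Fin 2) (Fin 2) ℂ :=
  Complex.I • ((2 * (μ + ν)) • pauli3 - (2 : ℂ) • potential q r)
    + ∑ k, (e k / ((μ - ζ k) * (ν - ζ k))) • sourceH (w k)

theorem laxT_trace (e ζ : S → ℂ) (w : S → Vec2) (q r qx rx z : ℂ) :
    (laxT e ζ w q r qx rx z).trace = 0 := by
  have h1 : (laxV z q r qx rx).trace = 0 := by
    simp [laxV, Matrix.trace_fin_two]; ring
  have h2 : ∀ k, (sourceH (w k)).trace = 0 := fun k => by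
    simp [sourceH, Matrix.trace_fin_two]
  simp [laxT, Matrix.trace_sum, h1, h2]

theorem laxT_sub {e ζ : S → ℂ} {w : S → Vec2} {q r qx rx μ ν : ℂ} (hμ : ∀ k, μ ≠ ζ k)
    (hν : ∀ k, ν ≠ ζ k) :
    laxT e ζ w q r qx rx ν - laxT e ζ w q r qx rx μ = (μ - ν) • laxTDiff e ζ w q r μ ν := by
  have h1 : ∀ k, (e k / (ν - ζ k)) • sourceH (w k) =
      (e k / (μ - ζ k)) • sourceH (w k)
        + (μ - ν) • ((e k / ((μ - ζ k) * (ν - ζ k))) • sourceH (w k)) := fun k => by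
    have h2 := sub_ne_zero.2 (hμ k)
    have h3 := sub_ne_zero.2 (hν k)
    rw [smul_smul, ← add_smul]
    congr 1
    field_simp
    ring
  simp only [laxT, laxTDiff, laxV_eq, h1, Finset.sum_add_distrib, ← Finset.smul_sum]
  module

/-- Continuity of `u` suffices because the scalar factor vanishes at `μ`. -/
theorem hasDerivAt_smul_of_continuousAt {u : ℂ → Vec2} {μ : ℂ} (hu : ContinuousAt u μ) :
    HasDerivAt (fun z => (μ - z) • u z) (-u μ) μ := by
  rw [hasDerivAt_iff_tendsto_slope]
  refine (hu.neg.tendsto.mono_left nhdsWithin_le_nhds).congr' ?_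
  filter_upwards [self_mem_nhdsWithin] with z hz
  rw [slope_def_module, sub_self, zero_smul, sub_zero, ← neg_sub z μ, neg_smul, smul_neg,
    inv_smul_smul₀ (sub_ne_zero.2 hz)]
  rfl

theorem continuousAt_mulVec {α : Type*} [TopologicalSpace α] {M : α → Matrix (Fin 2) (Fin 2) ℂ}
    {v : α → Vec2} {a : α} (hM : ∀ i j, ContinuousAt (fun x => M x i j) a)
    (hv : ContinuousAt v a) : ContinuousAt (fun x => M x *ᵥ v x) a := by
  rw [continuousAt_pi] at hv ⊢
  intro i
  simp only [Matrix.mulVec, dotProduct, Fin.sum_univ_two]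
  exact ((hM i 0).mul (hv 0)).add ((hM i 1).mul (hv 1))

/-- A product rule in which the derivative of `N` is read off the divided difference, as `-D μ`. It
provides the diagonal hypothesis of `hasDerivAt_sigma` for both flows. -/
theorem hasDerivAt_mulVec_of_diff {N : ℂ → Matrix (Fin 2) (Fin 2) ℂ}
    {D : ℂ → Matrix (Fin 2) (Fin 2) ℂ} {f : ℂ → Vec2} {μ : ℂ} (hf : DifferentiableAt ℂ f μ)
    (hND : ∀ᶠ z in 𝓝 μ, N z - N μ = (μ - z) • D z)
    (hD : ∀ i j, ContinuousAt (fun z => D z i j) μ) :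
    HasDerivAt (fun z => N z *ᵥ f z) (N μ *ᵥ deriv f μ - D μ *ᵥ f μ) μ := by
  have h1 : HasDerivAt (fun z => N μ *ᵥ f z) (N μ *ᵥ deriv f μ) μ := by
    rw [hasDerivAt_pi]
    intro i
    simp only [Matrix.mulVec, dotProduct]
    exact HasDerivAt.fun_sum fun k _ => (hasDerivAt_pi.1 hf.hasDerivAt k).const_mul _
  have h2 := hasDerivAt_smul_of_continuousAt (continuousAt_mulVec hD hf.continuousAt)
  refine ((h1.add h2).congr_deriv (by rw [sub_eq_add_neg])).congr_of_eventuallyEq ?_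
  filter_upwards [hND] with z hz
  rw [← sub_add_cancel (N z) (N μ), hz, Matrix.add_mulVec, Matrix.smul_mulVec, add_comm]
  rfl

end Temporal

/-! ### Solution families and doubled lists -/

section Families

variable {m : ℕ} {Ω : Set (ℝ × ℝ)} {lam : Fin m → ℂ} {q : ℝ → ℝ → ℂ} {φ : Fin m → ℝ → ℝ → Vec2}

/-- The doubled list of parameters `μ_j`, `-μ_j*`. -/
def doubleParam {N : ℕ} (mu : Fin N → ℂ) : Fin N × Bool → ℂ
  | (j, false) => mu j
  | (j, true) => -conj (mu j)

/-- The doubled list of vectors `φ_j`, `S₋ φ_j`. -/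
def doubleVec {N : ℕ} (w : Fin N → Vec2) : Fin N × Bool → Vec2
  | (j, false) => w j
  | (j, true) => sMinus (w j)

/-- The sign of a member of a doubled list. -/
def doubleSign {N : ℕ} : Fin N × Bool → ℂ
  | (_, false) => 1
  | (_, true) => -1

/-- The sources and their S₋ images become one list of weighted sources with weights ±1, so the
algebra need not know about the reduction. -/
theorem laxT_double (w : Fin m → Vec2) (q r qx rx z : ℂ) :
    laxV z q r qx rx + ∑ j, ((1 / (z - lam j)) • sourceH (w j)
        - (1 / (z + conj (lam j))) • sourceH (sMinus (w j))) =
      laxT doubleSign (doubleParam lam) (doubleVec w) q r qx rx z := by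
  simp only [laxT, Fintype.sum_prod_type, Fintype.sum_bool, doubleSign, doubleParam, doubleVec]
  congr 1
  refine Finset.sum_congr rfl fun j _ => ?_
  rw [sub_neg_eq_add, neg_div, neg_smul]
  abel

/-- The spatial derivatives of a solution family and of its parameter derivative. -/
theorem IsLaxFamily.hasDerivAt_x {μ : ℂ} {f : ℂ → ℝ → ℝ → Vec2}
    (hΩ : IsOpen Ω) (hf : IsLaxFamily Ω lam q φ μ f) {x t : ℝ} (hxt : (x, t) ∈ Ω) :
    HasDerivAt (fun y => deriv (fun z => f z y t) μ)
      (laxU μ (q x t) (-conj (q x t)) *ᵥ deriv (fun z => f z x t) μ - pauli3 *ᵥ f μ x t) x := by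
  obtain ⟨D, hD, hμ, hcd, hhol, hlax⟩ := hf
  have hev : ∀ᶠ y in 𝓝 x, (y, t) ∈ Ω :=
    (Continuous.prodMk_left t).continuousAt.eventually_mem (hΩ.mem_nhds hxt)
  have h1 := hasDerivAt_deriv_of_contDiffAt (f := fun z y => f z y t)
    (f' := fun z => laxU z (q x t) (-conj (q x t)) *ᵥ f z x t) hD hμ
    (fun z hz => (hcd.contDiffAt ((hD.prod hΩ).mem_nhds (Set.mk_mem_prod hz hxt))).comp
      (f := fun p : ℂ × ℝ => (p.1, p.2, t)) (z, x) (by fun_prop))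
    (hev.mono fun y hy => hhol y t hy) (fun z hz => (hlax z hz x t hxt).1)
  refine h1.congr_deriv (HasDerivAt.deriv ?_)
  exact hasDerivAt_mulVec_of_diff (D := fun _ => pauli3)
    ((hhol x t hxt).differentiableAt (hD.mem_nhds hμ))
    (Filter.Eventually.of_forall fun z => laxU_sub _ _ _ _) fun _ _ => continuousAt_const

/-- The temporal derivatives of a solution family and of its parameter derivative. -/
theorem IsLaxFamily.hasDerivAt_t {μ : ℂ} {f : ℂ → ℝ → ℝ → Vec2}
    (hΩ : IsOpen Ω) (hf : IsLaxFamily Ω lam q φ μ f) (hne : ∀ k, μ ≠ doubleParam lam k)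
    {x t : ℝ} (hxt : (x, t) ∈ Ω) :
    HasDerivAt (fun τ => deriv (fun z => f z x τ) μ)
      (laxT doubleSign (doubleParam lam) (doubleVec fun j => φ j x t) (q x t) (-conj (q x t))
          (deriv (fun y => q y t) x) (-conj (deriv (fun y => q y t) x)) μ
          *ᵥ deriv (fun z => f z x t) μ
        - laxTDiff doubleSign (doubleParam lam) (doubleVec fun j => φ j x t) (q x t)
          (-conj (q x t)) μ μ *ᵥ f μ x t) t := by
  obtain ⟨D, hD, hμ, hcd, hhol, hlax⟩ := hf
  have hev : ∀ᶠ τ in 𝓝 t, (x, τ) ∈ Ω :=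
    (Continuous.prodMk_right x).continuousAt.eventually_mem (hΩ.mem_nhds hxt)
  have h1 := hasDerivAt_deriv_of_contDiffAt (f := fun z τ => f z x τ)
    (f' := fun z => laxT doubleSign (doubleParam lam) (doubleVec fun j => φ j x t) (q x t)
      (-conj (q x t)) (deriv (fun y => q y t) x) (-conj (deriv (fun y => q y t) x)) z
      *ᵥ f z x t) hD hμ
    (fun z hz => (hcd.contDiffAt ((hD.prod hΩ).mem_nhds (Set.mk_mem_prod hz hxt))).comp
      (f := fun p : ℂ × ℝ => (p.1, x, p.2)) (z, t) (by fun_prop))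
    (hev.mono fun y hy => hhol x y hy)
    (fun z hz => by rw [← laxT_double]; exact (hlax z hz x t hxt).2)
  refine h1.congr_deriv (HasDerivAt.deriv ?_)
  refine hasDerivAt_mulVec_of_diff
    (D := fun z => laxTDiff doubleSign (doubleParam lam) (doubleVec fun j => φ j x t) (q x t)
      (-conj (q x t)) μ z)
    ((hhol x t hxt).differentiableAt (hD.mem_nhds hμ)) ?_ fun i j => ?_
  · have : ∀ᶠ z in 𝓝 μ, ∀ k, z ≠ doubleParam lam k :=
      Filter.eventually_all.2 fun k => eventually_ne_nhds (hne k)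
    filter_upwards [this] with z hz
    exact laxT_sub hne hz
  · simp only [laxTDiff, Matrix.add_apply, Matrix.smul_apply, Matrix.sub_apply,
      Matrix.sum_apply, smul_eq_mul]
    have : ∀ k, (μ - doubleParam lam k) * (μ - doubleParam lam k) ≠ 0 := fun k =>
      mul_ne_zero (sub_ne_zero.2 (hne k)) (sub_ne_zero.2 (hne k))
    refine ContinuousAt.add (by fun_prop) (tendsto_finsetSum _ fun k _ => ?_)
    have hk : ContinuousAt (fun z => (doubleSign k : ℂ)
        / ((μ - doubleParam lam k) * (z - doubleParam lam k))) μ :=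
      ContinuousAt.div (by fun_prop) (by fun_prop) (this k)
    exact hk.mul continuousAt_const

end Families

/-! ### Cauchy matrices and Sylvester equations -/

section CauchyMatrices

variable {ι S p : Type}

/-- The matrix with entries `-W(g_i, w_k) / (2(κ_i - ζ_k))`. -/
def cauchyMat (κ : ι → ℂ) (ζ : S → ℂ) (G : Matrix (Fin 2) ι ℂ) (W : Matrix (Fin 2) S ℂ) :
    Matrix ι S ℂ :=
  Matrix.of fun i k => -(wronskian (Gᵀ i) (Wᵀ k)) / (2 * (κ i - ζ k))

theorem wronskian_eq_mul (G : Matrix (Fin 2) ι ℂ) (W : Matrix (Fin 2) S ℂ) (i : ι) (k : S) :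
    wronskian (Gᵀ i) (Wᵀ k) = (Gᵀ * matJ * W) i k := by
  simp [wronskian, Matrix.mul_apply, matJ, Fin.sum_univ_two]
  ring

theorem cauchyMat_transpose (κ : ι → ℂ) (ζ : S → ℂ) (G : Matrix (Fin 2) ι ℂ)
    (W : Matrix (Fin 2) S ℂ) : (cauchyMat κ ζ G W)ᵀ = cauchyMat ζ κ W G := by
  ext k i
  simp only [cauchyMat, Matrix.transpose_apply, Matrix.of_apply]
  rw [wronskian_comm, neg_neg, ← neg_sub (ζ k), mul_neg, div_neg, neg_div]

variable [Fintype ι] [DecidableEq ι] [Fintype S] [DecidableEq S] [Fintype p] [DecidableEq p]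

theorem cauchyMat_commutator {κ : ι → ℂ} {ζ : S → ℂ} (G : Matrix (Fin 2) ι ℂ)
    (W : Matrix (Fin 2) S ℂ) (hne : ∀ i k, κ i ≠ ζ k) :
    Matrix.diagonal κ * cauchyMat κ ζ G W - cauchyMat κ ζ G W * Matrix.diagonal ζ =
      -((1 / 2 : ℂ) • (Gᵀ * matJ * W)) := by
  ext i k
  have h := sub_ne_zero.2 (hne i k)
  simp only [Matrix.sub_apply, Matrix.diagonal_mul, Matrix.mul_diagonal, Matrix.neg_apply,
    Matrix.smul_apply, smul_eq_mul, ← wronskian_eq_mul, cauchyMat, Matrix.of_apply]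
  field_simp
  ring

theorem cauchyMat_commutator_const {κ : ι → ℂ} {z : ℂ} (G : Matrix (Fin 2) ι ℂ)
    (ψ : Matrix (Fin 2) p ℂ) (hne : ∀ i, κ i ≠ z) :
    Matrix.diagonal κ * cauchyMat κ (fun _ => z) G ψ - z • cauchyMat κ (fun _ => z) G ψ =
      -((1 / 2 : ℂ) • (Gᵀ * matJ * ψ)) := by
  rw [← cauchyMat_commutator G ψ (fun i _ => hne i), Matrix.smul_eq_mul_diagonal]

/-- With disjoint diagonal spectra a Sylvester equation is solved entry by entry. Dressed pairings
are identified this way, without computing them. -/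
theorem eq_cauchyMat {κ : ι → ℂ} {ζ : S → ℂ} {G : Matrix (Fin 2) ι ℂ}
    {W : Matrix (Fin 2) S ℂ} (hne : ∀ i k, κ i ≠ ζ k) {X : Matrix ι S ℂ}
    (hX : Matrix.diagonal κ * X - X * Matrix.diagonal ζ = -((1 / 2 : ℂ) • (Gᵀ * matJ * W))) :
    X = cauchyMat κ ζ G W := by
  ext i k
  have h := sub_ne_zero.2 (hne i k)
  have h1 := congrFun (congrFun hX i) k
  simp only [Matrix.sub_apply, Matrix.diagonal_mul, Matrix.mul_diagonal, Matrix.neg_apply,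
    Matrix.smul_apply, smul_eq_mul, ← wronskian_eq_mul] at h1
  simp only [cauchyMat, Matrix.of_apply]
  field_simp
  linear_combination 2 * h1

omit [Fintype p] [DecidableEq p] in
theorem sum_smul_sourceH_mulVec (e ζ : S → ℂ) (W : Matrix (Fin 2) S ℂ)
    (z : p → ℂ) (ψ : Matrix (Fin 2) p ℂ) (a : Fin 2) (j : p) :
    ((∑ k, (e k / (z j - ζ k)) • sourceH (Wᵀ k)) *ᵥ (ψᵀ j)) a =
      (W * Matrix.diagonal e * cauchyMat ζ z W ψ) a j := by
  rw [Matrix.sum_mulVec, Matrix.mul_apply, Finset.sum_apply]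
  refine Finset.sum_congr rfl fun k _ => ?_
  rw [Matrix.smul_mulVec, sourceH_mulVec]
  simp only [Pi.smul_apply, smul_eq_mul, Matrix.mul_diagonal, cauchyMat, Matrix.of_apply,
    Matrix.transpose_apply]
  rw [← neg_sub (z j), mul_neg, neg_div_neg_eq]
  -- At a coincidence of parameters both sides vanish, as division by zero gives zero; no
  -- distinctness is needed.
  by_cases h : z j - ζ k = 0
  · simp [h]
  · field_simp

end CauchyMatrices

/-! ### The matrix A, its inverse and its spatial derivative -/

section Dressing

variable {ι : Type} [Fintype ι] [DecidableEq ι]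

/-- The pairs `{c_i, g_i}` at the point `(x, t)`. -/
def familyPairs (κ : ι → ℂ) (g : ι → ℂ → ℝ → ℝ → Vec2) (c : ι → ℝ → ℂ) (x t : ℝ) (i : ι) : Pair :=
  ⟨c i t, ⟨κ i, fun z => g i z x t⟩⟩

/-- The matrix with columns `g_i`. -/
def columns (κ : ι → ℂ) (g : ι → ℂ → ℝ → ℝ → Vec2) (x t : ℝ) : Matrix (Fin 2) ι ℂ :=
  Matrix.of fun k i => g i (κ i) x t k

/-- The inverse of the matrix `A`. -/
def resolvent (κ : ι → ℂ) (g : ι → ℂ → ℝ → ℝ → Vec2) (c : ι → ℝ → ℂ) (x t : ℝ) : Matrix ι ι ℂ :=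
  (matA (familyPairs κ g c x t))⁻¹

omit [Fintype ι] [DecidableEq ι] in
theorem sigma_comm_of_ne {g h : SpectralVector} (hne : g.param ≠ h.param) :
    sigma g h = sigma h g := by
  rw [sigma_of_ne hne, sigma_of_ne hne.symm, wronskian_comm, neg_neg, ← neg_sub h.param,
    mul_neg, div_neg, neg_div]

variable {κ : ι → ℂ} (g : ι → ℂ → ℝ → ℝ → Vec2) (c : ι → ℝ → ℂ) (x t : ℝ)

omit [Fintype ι] in
theorem matA_transpose (hκ : Function.Injective κ) :
    (matA (familyPairs κ g c x t))ᵀ = matA (familyPairs κ g c x t) := by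
  ext i j
  by_cases h : i = j
  · subst h; rfl
  · simp only [matA, Matrix.transpose_apply, Matrix.of_apply, if_neg h, if_neg (Ne.symm h)]
    rw [sigma_comm_of_ne]
    exact fun he => h (hκ he).symm

/-- Off the diagonal the commutator clears the denominator of σ. On the diagonal both sides vanish,
so neither the c's nor the parameter derivatives of the vectors enter. -/
theorem matA_commutator (hκ : Function.Injective κ) :
    Matrix.diagonal κ * matA (familyPairs κ g c x t)
        - matA (familyPairs κ g c x t) * Matrix.diagonal κ =
      -((1 / 2 : ℂ) • ((columns κ g x t)ᵀ * matJ * columns κ g x t)) := by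
  ext i j
  simp only [Matrix.sub_apply, Matrix.diagonal_mul, Matrix.mul_diagonal, Matrix.neg_apply,
    Matrix.smul_apply, smul_eq_mul, ← wronskian_eq_mul]
  by_cases h : i = j
  · subst h; rw [wronskian_self]; ring
  · have hne : κ i ≠ κ j := fun he => h (hκ he)
    have h1 := sub_ne_zero.2 hne
    simp only [matA, Matrix.of_apply, if_neg h]
    rw [sigma_of_ne hne]
    simp only [familyPairs, SpectralVector.value]
    change _ = -(1 / 2 * wronskian (g i (κ i) x t) (g j (κ j) x t))
    field_simp
    ring

variable {g c x t}

theorem matA_mul_resolvent (hdet : (matA (familyPairs κ g c x t)).det ≠ 0) :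
    matA (familyPairs κ g c x t) * resolvent κ g c x t = 1 :=
  Matrix.mul_nonsing_inv _ (isUnit_iff_ne_zero.2 hdet)

theorem resolvent_mul_matA (hdet : (matA (familyPairs κ g c x t)).det ≠ 0) :
    resolvent κ g c x t * matA (familyPairs κ g c x t) = 1 :=
  Matrix.nonsing_inv_mul _ (isUnit_iff_ne_zero.2 hdet)

theorem resolvent_transpose (hκ : Function.Injective κ) :
    (resolvent κ g c x t)ᵀ = resolvent κ g c x t := by
  rw [resolvent, Matrix.transpose_nonsing_inv, matA_transpose g c x t hκ]

/-- The forms `W₁` and `W₂` as bilinear expressions in the inverse of `A`. -/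
theorem det_bordered {A : Matrix ι ι ℂ} (hdet : A.det ≠ 0) (u v : ι → ℂ) (d : ℂ) :
    A.det⁻¹ * (Matrix.fromBlocks A (Matrix.replicateCol Unit u) (Matrix.replicateRow Unit v)
      (Matrix.of fun _ _ : Unit => d)).det = d - v ⬝ᵥ A⁻¹ *ᵥ u := by
  have : Invertible A := Matrix.invertibleOfIsUnitDet A (isUnit_iff_ne_zero.2 hdet)
  rw [Matrix.det_fromBlocks₁₁, inv_mul_cancel_left₀ hdet, Matrix.det_unique,
    Matrix.invOf_eq_nonsing_inv]
  simp only [Matrix.sub_apply, Matrix.of_apply]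
  congr 1
  rw [Matrix.mul_assoc]
  rfl

variable {m : ℕ} {Ω : Set (ℝ × ℝ)} {lam : Fin m → ℂ} {q : ℝ → ℝ → ℂ} {φ : Fin m → ℝ → ℝ → Vec2}

/-- The divided difference of `laxU` is the constant `pauli3`, and -W(g, σ₃h) = gᵀσ₁h. The
derivative thus has rank at most two, whatever the size of A. -/
theorem hasEntryDerivAt_matA_x (hκ : Function.Injective κ) (hΩ : IsOpen Ω)
    (hg : ∀ i, IsLaxFamily Ω lam q φ (κ i) (g i)) (hxt : (x, t) ∈ Ω) :
    HasEntryDerivAt (fun y => matA (familyPairs κ g c y t))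
      ((1 / 2 : ℂ) • ((columns κ g x t)ᵀ * pauli1 * columns κ g x t)) x := by
  intro i j
  have hlax : ∀ i, HasDerivAt (fun y => g i (κ i) y t)
      (laxU (κ i) (q x t) (-conj (q x t)) *ᵥ g i (κ i) x t) x := fun i => by
    obtain ⟨D, -, hμ, -, -, h⟩ := hg i
    exact (h _ hμ x t hxt).1
  have h1 := hasDerivAt_sigma (g := fun z y => g i z y t) (h := fun z y => g j z y t)
    (hlax i) (hlax j) (laxU_trace _ _ _) (laxU_sub _ _ _ _)
    (fun hij => by obtain rfl := hκ hij; exact (hg i).hasDerivAt_x hΩ hxt)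
  refine (h1.const_add (if i = j then c i t else 0)).congr_deriv ?_
  simp [wronskian, pauli1, pauli3, columns, Matrix.mul_apply, Fin.sum_univ_two, Matrix.mulVec,
    dotProduct]
  ring

theorem hasEntryDerivAt_columns_x
    (hg : ∀ i, IsLaxFamily Ω lam q φ (κ i) (g i)) (hxt : (x, t) ∈ Ω) :
    HasEntryDerivAt (fun y => columns κ g y t)
      (-(pauli3 * columns κ g x t * Matrix.diagonal κ)
        + potential (q x t) (-conj (q x t)) * columns κ g x t) x := by
  intro k i
  obtain ⟨D, -, hμ, -, -, h⟩ := hg i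
  refine (hasDerivAt_pi.1 (h _ hμ x t hxt).1 k).congr_deriv ?_
  rw [laxU_eq, Matrix.add_mulVec, Matrix.neg_mulVec, Matrix.smul_mulVec]
  simp only [Matrix.add_apply, Matrix.neg_apply, Matrix.mul_diagonal, Pi.add_apply, Pi.neg_apply,
    Pi.smul_apply, smul_eq_mul, mul_comm _ (κ i)]
  rfl

end Dressing

/-! ### Temporal flow in matrix form -/

section TemporalEntries

variable {ι S p : Type} [Fintype ι] [DecidableEq ι] [Fintype S] [DecidableEq S] [Fintype p]
  [DecidableEq p]

omit [Fintype ι] [DecidableEq ι] in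
theorem laxT_mulVec_apply (e ζ : S → ℂ) (W : Matrix (Fin 2) S ℂ) (q r qx rx : ℂ) (z : p → ℂ)
    (ψ : Matrix (Fin 2) p ℂ) (a : Fin 2) (j : p) :
    (laxT e ζ (fun k => Wᵀ k) q r qx rx (z j) *ᵥ ψᵀ j) a =
      (Complex.I • (-((2 : ℂ) • (pauli3 * ψ * Matrix.diagonal z * Matrix.diagonal z))
          + (2 : ℂ) • (potential q r * ψ * Matrix.diagonal z) + laxVZero q r qx rx * ψ)
        + W * Matrix.diagonal e * cauchyMat ζ z W ψ) a j := by
  rw [laxT, Matrix.add_mulVec, Pi.add_apply, sum_smul_sourceH_mulVec, Matrix.add_apply, laxV_eq]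
  congr 1
  simp only [Matrix.smul_mulVec, Matrix.add_mulVec, Matrix.neg_mulVec, Pi.smul_apply,
    Pi.add_apply, Pi.neg_apply, Matrix.smul_apply, Matrix.add_apply, Matrix.neg_apply,
    Matrix.mul_diagonal, smul_eq_mul]
  change Complex.I * (-(2 * z j ^ 2 * (pauli3 * ψ) a j) + 2 * z j * (potential q r * ψ) a j
    + (laxVZero q r qx rx * ψ) a j) = _
  ring

/-- The divided difference of a simple pole factorises as 1/((μ - ζ)(ν - ζ)), and H has rank one;
the sum over sources is therefore a product of two Cauchy matrices. -/
theorem wronskian_laxTDiff {e ζ : S → ℂ} {W : Matrix (Fin 2) S ℂ} (q r : ℂ) {κ : ι → ℂ}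
    {z : p → ℂ} (G : Matrix (Fin 2) ι ℂ) (H : Matrix (Fin 2) p ℂ) (hκ : ∀ i k, κ i ≠ ζ k)
    (hz : ∀ j k, z j ≠ ζ k) (i : ι) (j : p) :
    -(1 / 2) * wronskian (Gᵀ i) (laxTDiff e ζ (fun k => Wᵀ k) q r (κ i) (z j) *ᵥ Hᵀ j) =
      (Complex.I • (Matrix.diagonal κ * Gᵀ * pauli1 * H + Gᵀ * pauli1 * H * Matrix.diagonal z
          + Gᵀ * matJ * potential q r * H)
        + cauchyMat κ ζ G W * Matrix.diagonal e * cauchyMat ζ z W H) i j := by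
  have h1 : ∀ u v : Vec2, wronskian (Gᵀ i) (u + v) = wronskian (Gᵀ i) u + wronskian (Gᵀ i) v :=
    fun u v => by simp [wronskian]; ring
  have h2 : wronskian (Gᵀ i) ((∑ k, (e k / ((κ i - ζ k) * (z j - ζ k))) • sourceH (Wᵀ k))
      *ᵥ Hᵀ j) = ∑ k, e k / ((κ i - ζ k) * (z j - ζ k)) *
        (1 / 2 * wronskian (Wᵀ k) (Hᵀ j) * wronskian (Gᵀ i) (Wᵀ k)) := by
    simp only [Matrix.sum_mulVec, Matrix.smul_mulVec, sourceH_mulVec, wronskian,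
      Finset.sum_apply, Pi.smul_apply, smul_eq_mul, Finset.mul_sum, ← Finset.sum_sub_distrib]
    refine Finset.sum_congr rfl fun k _ => ?_
    ring
  rw [laxTDiff, Matrix.add_mulVec, h1, h2, mul_add, Matrix.add_apply]
  congr 1
  · have h3 : Matrix.diagonal κ * Gᵀ * pauli1 * H = Matrix.diagonal κ * (Gᵀ * pauli1 * H) := by
      simp only [Matrix.mul_assoc]
    rw [h3]
    simp only [Matrix.smul_apply, Matrix.add_apply, Matrix.mul_diagonal, Matrix.diagonal_mul]
    simp only [Matrix.mul_apply, Fin.sum_univ_two]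
    simp [wronskian, pauli1, pauli3, potential, matJ, Matrix.mulVec, dotProduct]
    ring
  · rw [Matrix.mul_apply, Finset.mul_sum]
    refine Finset.sum_congr rfl fun k _ => ?_
    have h3 := sub_ne_zero.2 (hκ i k)
    have h4 := sub_ne_zero.2 (hz j k)
    simp only [Matrix.mul_diagonal, cauchyMat, Matrix.of_apply]
    rw [← neg_sub (z j) (ζ k)]
    field_simp

end TemporalEntries

/-! ### Derivatives of the columns, of A and of σ(g, ψ) -/

section Derivatives

variable {ι : Type} [Fintype ι] [DecidableEq ι] {κ : ι → ℂ} {g : ι → ℂ → ℝ → ℝ → Vec2}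
  {c : ι → ℝ → ℂ} {x t : ℝ} {m : ℕ} {Ω : Set (ℝ × ℝ)} {lam : Fin m → ℂ} {q : ℝ → ℝ → ℂ}
  {φ : Fin m → ℝ → ℝ → Vec2}

/-- The matrix with columns `φ_j`, `S₋ φ_j`. -/
def sourceMat (φ : Fin m → ℝ → ℝ → Vec2) (x t : ℝ) : Matrix (Fin 2) (Fin m × Bool) ℂ :=
  Matrix.of fun a k => doubleVec (fun j => φ j x t) k a

/-- The diagonal matrix of the signs of a doubled list. -/
def signMat (m : ℕ) : Matrix (Fin m × Bool) (Fin m × Bool) ℂ :=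
  Matrix.diagonal doubleSign

theorem hasEntryDerivAt_columns_t (hg : ∀ i, IsLaxFamily Ω lam q φ (κ i) (g i))
    (hxt : (x, t) ∈ Ω) :
    HasEntryDerivAt (fun τ => columns κ g x τ)
      (columnsFlow (q x t) (-conj (q x t)) (deriv (fun y => q y t) x)
        (-conj (deriv (fun y => q y t) x)) (columns κ g x t) (Matrix.diagonal κ)
        (sourceMat φ x t) (signMat m)
        (cauchyMat κ (doubleParam lam) (columns κ g x t) (sourceMat φ x t))) t := by
  intro a i
  obtain ⟨D, -, hμ, -, -, h⟩ := hg i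
  have h1 := hasDerivAt_pi.1 (h _ hμ x t hxt).2 a
  rw [laxT_double] at h1
  refine h1.congr_deriv ?_
  rw [columnsFlow, cauchyMat_transpose, signMat, ← laxT_mulVec_apply]
  rfl

theorem hasEntryDerivAt_matA_t (hκ : Function.Injective κ) (hΩ : IsOpen Ω)
    (hg : ∀ i, IsLaxFamily Ω lam q φ (κ i) (g i)) (hne : ∀ i k, κ i ≠ doubleParam lam k)
    (hxt : (x, t) ∈ Ω) {c' : ι → ℂ} (hc : ∀ i, HasDerivAt (c i) (c' i) t) :
    HasEntryDerivAt (fun τ => matA (familyPairs κ g c x τ))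
      (matAFlow (q x t) (-conj (q x t)) (columns κ g x t) (Matrix.diagonal κ)
        (Matrix.diagonal c') (signMat m)
        (cauchyMat κ (doubleParam lam) (columns κ g x t) (sourceMat φ x t))) t := by
  intro i j
  have hlax : ∀ i, HasDerivAt (fun τ => g i (κ i) x τ)
      (laxT doubleSign (doubleParam lam) (doubleVec fun j => φ j x t) (q x t) (-conj (q x t))
        (deriv (fun y => q y t) x) (-conj (deriv (fun y => q y t) x)) (κ i)
        *ᵥ g i (κ i) x t) t := fun i => by
    obtain ⟨D, -, hμ, -, -, h⟩ := hg i
    rw [← laxT_double]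
    exact (h _ hμ x t hxt).2
  have h1 := hasDerivAt_sigma (g := fun z τ => g i z x τ) (h := fun z τ => g j z x τ)
    (hlax i) (hlax j) (laxT_trace _ _ _ _ _ _ _ _) (laxT_sub (hne i) (hne j))
    (fun hij => by obtain rfl := hκ hij; exact (hg i).hasDerivAt_t hΩ (hne i) hxt)
  have h2 : HasDerivAt (fun τ => if i = j then c i τ else 0)
      (Matrix.diagonal c' i j) t := by
    by_cases h : i = j
    · subst h; simpa using hc i
    · simpa [h] using hasDerivAt_const t (0 : ℂ)
  refine (h2.add h1).congr_deriv ?_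
  rw [matAFlow, cauchyMat_transpose, add_assoc, Matrix.add_apply, signMat,
    ← wronskian_laxTDiff _ _ _ _ hne hne]
  rfl

/-- The column `σ(g_i, ψ)`. -/
def sigmaCol (κ : ι → ℂ) (g : ι → ℂ → ℝ → ℝ → Vec2) (z : ℂ) (ψ : ℝ → ℝ → Vec2) (x t : ℝ) :
    Matrix ι Unit ℂ :=
  cauchyMat κ (fun _ => z) (columns κ g x t) (Matrix.replicateCol Unit (ψ x t))

omit [Fintype ι] [DecidableEq ι] in
theorem sigmaCol_apply {z : ℂ} (hz : ∀ i, κ i ≠ z) (ψ : ℝ → ℝ → Vec2) (x t : ℝ) (i : ι)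
    (u : Unit) :
    sigmaCol κ g z ψ x t i u = sigma ⟨κ i, fun w => g i w x t⟩ ⟨z, fun _ => ψ x t⟩ := by
  rw [sigma_of_ne (hz i)]
  rfl

theorem hasEntryDerivAt_sigmaCol_x {z : ℂ} (hz : ∀ i, κ i ≠ z)
    (hg : ∀ i, IsLaxFamily Ω lam q φ (κ i) (g i)) (hxt : (x, t) ∈ Ω) {ψ : ℝ → ℝ → Vec2}
    (hψ : HasDerivAt (fun y => ψ y t) (laxU z (q x t) (-conj (q x t)) *ᵥ ψ x t) x) :
    HasEntryDerivAt (fun y => sigmaCol κ g z ψ y t)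
      ((1 / 2 : ℂ) • ((columns κ g x t)ᵀ * pauli1 * Matrix.replicateCol Unit (ψ x t))) x := by
  intro i u
  simp only [sigmaCol_apply hz]
  have hlax : HasDerivAt (fun y => g i (κ i) y t)
      (laxU (κ i) (q x t) (-conj (q x t)) *ᵥ g i (κ i) x t) x := by
    obtain ⟨D, -, hμ, -, -, h⟩ := hg i
    exact (h _ hμ x t hxt).1
  refine (hasDerivAt_sigma (g := fun z y => g i z y t) (h := fun _ y => ψ y t) hlax hψ
    -- The vector ψ is attached to its parameter as a constant family; this is harmless because `hz`
    -- excludes the branch of σ that differentiates it.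
    (laxU_trace _ _ _) (laxU_sub _ _ _ _) fun h => absurd h (hz i)).congr_deriv ?_
  simp [wronskian, pauli1, pauli3, columns, Matrix.mul_apply, Fin.sum_univ_two, Matrix.mulVec,
    dotProduct]
  ring

theorem hasEntryDerivAt_sigmaCol_t {z : ℂ} (hz : ∀ i, κ i ≠ z)
    (hg : ∀ i, IsLaxFamily Ω lam q φ (κ i) (g i)) (hne : ∀ i k, κ i ≠ doubleParam lam k)
    (hzne : ∀ k, z ≠ doubleParam lam k) (hxt : (x, t) ∈ Ω) {ψ : ℝ → ℝ → Vec2}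
    (hψ : HasDerivAt (fun τ => ψ x τ) (laxT doubleSign (doubleParam lam)
      (doubleVec fun j => φ j x t) (q x t) (-conj (q x t)) (deriv (fun y => q y t) x)
      (-conj (deriv (fun y => q y t) x)) z *ᵥ ψ x t) t) :
    HasEntryDerivAt (fun τ => sigmaCol κ g z ψ x τ)
      (Complex.I • (Matrix.diagonal κ * (columns κ g x t)ᵀ * pauli1
            * Matrix.replicateCol Unit (ψ x t)
          + z • ((columns κ g x t)ᵀ * pauli1 * Matrix.replicateCol Unit (ψ x t))
          + (columns κ g x t)ᵀ * matJ * potential (q x t) (-conj (q x t))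
            * Matrix.replicateCol Unit (ψ x t))
        + cauchyMat κ (doubleParam lam) (columns κ g x t) (sourceMat φ x t)
          * signMat m
          * cauchyMat (doubleParam lam) (fun _ => z) (sourceMat φ x t)
            (Matrix.replicateCol Unit (ψ x t))) t := by
  intro i u
  simp only [sigmaCol_apply hz]
  have hlax : HasDerivAt (fun τ => g i (κ i) x τ)
      (laxT doubleSign (doubleParam lam) (doubleVec fun j => φ j x t) (q x t) (-conj (q x t))
        (deriv (fun y => q y t) x) (-conj (deriv (fun y => q y t) x)) (κ i)
        *ᵥ g i (κ i) x t) t := by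
    obtain ⟨D, -, hμ, -, -, h⟩ := hg i
    rw [← laxT_double]
    exact (h _ hμ x t hxt).2
  refine (hasDerivAt_sigma (g := fun z τ => g i z x τ) (h := fun _ τ => ψ x τ) hlax hψ
    (laxT_trace _ _ _ _ _ _ _ _) (laxT_sub (hne i) hzne)
    fun h => absurd h (hz i)).congr_deriv ?_
  rw [Matrix.smul_eq_mul_diagonal _ z, signMat, ← wronskian_laxTDiff _ _ _ _ hne (fun _ => hzne)]
  rfl

end Derivatives

/-! ### Derivatives of the dressed objects -/

section DressedDerivatives

variable {ι : Type} [Fintype ι] [DecidableEq ι] {κ : ι → ℂ} {g : ι → ℂ → ℝ → ℝ → Vec2}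
  {c : ι → ℝ → ℂ} {x t : ℝ} {m : ℕ} {Ω : Set (ℝ × ℝ)} {lam : Fin m → ℂ} {q : ℝ → ℝ → ℂ}
  {φ : Fin m → ℝ → ℝ → Vec2}

/-- The Gram matrix `G A⁻¹ Gᵀ` at the point `(x, t)`. -/
def gramAt (κ : ι → ℂ) (g : ι → ℂ → ℝ → ℝ → Vec2) (c : ι → ℝ → ℂ) (x t : ℝ) :
    Matrix (Fin 2) (Fin 2) ℂ :=
  gram (columns κ g x t) (resolvent κ g c x t)

/-- The first moment `G K A⁻¹ Gᵀ` at the point `(x, t)`. -/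
def momentAt (κ : ι → ℂ) (g : ι → ℂ → ℝ → ℝ → Vec2) (c : ι → ℝ → ℂ) (x t : ℝ) :
    Matrix (Fin 2) (Fin 2) ℂ :=
  columns κ g x t * Matrix.diagonal κ * resolvent κ g c x t * (columns κ g x t)ᵀ

/-- The second moment `G K A⁻¹ K Gᵀ` at the point `(x, t)`. -/
def momentAt2 (κ : ι → ℂ) (g : ι → ℂ → ℝ → ℝ → Vec2) (c : ι → ℝ → ℂ) (x t : ℝ) :
    Matrix (Fin 2) (Fin 2) ℂ :=
  columns κ g x t * Matrix.diagonal κ * resolvent κ g c x t * Matrix.diagonal κ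
    * (columns κ g x t)ᵀ

/-- The dressed columns `G A⁻¹`. -/
def dressedColumns (κ : ι → ℂ) (g : ι → ℂ → ℝ → ℝ → Vec2) (c : ι → ℝ → ℂ) (x t : ℝ) :
    Matrix (Fin 2) ι ℂ :=
  columns κ g x t * resolvent κ g c x t

/-- The dressed vector `ψ - G A⁻¹ σ(g, ψ)`. -/
def dressedCol (κ : ι → ℂ) (g : ι → ℂ → ℝ → ℝ → Vec2) (c : ι → ℝ → ℂ) (z : ℂ)
    (ψ : ℝ → ℝ → Vec2) (x t : ℝ) : Matrix (Fin 2) Unit ℂ :=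
  Matrix.replicateCol Unit (ψ x t)
    - columns κ g x t * resolvent κ g c x t * sigmaCol κ g z ψ x t

theorem pauli3_transpose : pauli3ᵀ = pauli3 := transpose_of_fin_two _ _ _ _

theorem hasEntryDerivAt_resolvent_x (hκ : Function.Injective κ) (hΩ : IsOpen Ω)
    (hg : ∀ i, IsLaxFamily Ω lam q φ (κ i) (g i)) (hxt : (x, t) ∈ Ω)
    (hdet : (matA (familyPairs κ g c x t)).det ≠ 0) :
    HasEntryDerivAt (fun y => resolvent κ g c y t)
      (-(resolvent κ g c x t * ((1 / 2 : ℂ) • ((columns κ g x t)ᵀ * pauli1 * columns κ g x t))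
        * resolvent κ g c x t)) x :=
  (hasEntryDerivAt_matA_x hκ hΩ hg hxt).inv hdet

theorem hasEntryDerivAt_dressedColumns_x (hκ : Function.Injective κ) (hΩ : IsOpen Ω)
    (hg : ∀ i, IsLaxFamily Ω lam q φ (κ i) (g i)) (hxt : (x, t) ∈ Ω)
    (hdet : (matA (familyPairs κ g c x t)).det ≠ 0) :
    HasEntryDerivAt (fun y => dressedColumns κ g c y t)
      (-(pauli3 * dressedColumns κ g c x t * Matrix.diagonal κ)
        + potential (q x t - gramAt κ g c x t 0 0) (-conj (q x t) - gramAt κ g c x t 1 1)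
          * dressedColumns κ g c x t) x :=
  ((hasEntryDerivAt_columns_x hg hxt).mul
    (hasEntryDerivAt_resolvent_x hκ hΩ hg hxt hdet)).congr_deriv
    (dressed_columns_x (matA_mul_resolvent hdet) (resolvent_mul_matA hdet)
      (resolvent_transpose hκ) (matA_commutator g c x t hκ) _ _)

theorem replicateCol_mulVec (N : Matrix (Fin 2) (Fin 2) ℂ) (v : Vec2) :
    Matrix.replicateCol Unit (N *ᵥ v) = N * Matrix.replicateCol Unit v := rfl

theorem hasEntryDerivAt_replicateCol {ψ : ℝ → Vec2} {ψ' : Vec2} {s : ℝ} (h : HasDerivAt ψ ψ' s) :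
    HasEntryDerivAt (fun τ => Matrix.replicateCol Unit (ψ τ)) (Matrix.replicateCol Unit ψ') s :=
  fun i _ => hasDerivAt_pi.1 h i

theorem hasEntryDerivAt_dressedCol_x (hκ : Function.Injective κ) (hΩ : IsOpen Ω)
    (hg : ∀ i, IsLaxFamily Ω lam q φ (κ i) (g i)) (hxt : (x, t) ∈ Ω)
    (hdet : (matA (familyPairs κ g c x t)).det ≠ 0) {z : ℂ} (hz : ∀ i, κ i ≠ z)
    {ψ : ℝ → ℝ → Vec2}
    (hψ : HasDerivAt (fun y => ψ y t) (laxU z (q x t) (-conj (q x t)) *ᵥ ψ x t) x) :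
    HasEntryDerivAt (fun y => dressedCol κ g c z ψ y t)
      (laxU z (q x t - gramAt κ g c x t 0 0) (-conj (q x t) - gramAt κ g c x t 1 1)
        * dressedCol κ g c z ψ x t) x := by
  have h1 := (hasEntryDerivAt_replicateCol hψ).sub
    (((hasEntryDerivAt_columns_x hg hxt).mul
      (hasEntryDerivAt_resolvent_x (c := c) hκ hΩ hg hxt hdet)).mul
      (hasEntryDerivAt_sigmaCol_x hz hg hxt hψ))
  refine h1.congr_deriv ?_
  rw [replicateCol_mulVec, laxU_eq, laxU_eq]
  exact dressed_vector_x (matA_mul_resolvent hdet) (resolvent_mul_matA hdet)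
    (resolvent_transpose hκ) (matA_commutator g c x t hκ) _ _
    (cauchyMat_commutator_const _ _ hz)

theorem hasEntryDerivAt_gramAt_x (hκ : Function.Injective κ) (hΩ : IsOpen Ω)
    (hg : ∀ i, IsLaxFamily Ω lam q φ (κ i) (g i)) (hxt : (x, t) ∈ Ω)
    (hdet : (matA (familyPairs κ g c x t)).det ≠ 0) :
    HasEntryDerivAt (fun y => gramAt κ g c y t)
      (gramDeriv (q x t) (-conj (q x t)) (gramAt κ g c x t) (momentAt κ g c x t)) x := by
  have hG := hasEntryDerivAt_columns_x hg hxt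
  refine ((hG.mul (hasEntryDerivAt_resolvent_x (c := c) hκ hΩ hg hxt hdet)).mul
    hG.transpose).congr_deriv ?_
  simp only [gramDeriv, gramAt, gram, momentAt, Matrix.transpose_add,
    Matrix.transpose_neg, Matrix.transpose_mul, Matrix.transpose_transpose,
    resolvent_transpose hκ, Matrix.diagonal_transpose, pauli3_transpose, Matrix.add_mul,
    Matrix.mul_add, Matrix.neg_mul, Matrix.mul_neg, Matrix.smul_mul,
    Matrix.mul_smul, Matrix.mul_assoc]
  module

/-- Differentiating the first moment produces G K² R Gᵀ. Splitting the two factors K around R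
replaces it by the symmetric second moment, the form in which the flow identities are stated. -/
theorem moment_succ (hκ : Function.Injective κ)
    (hdet : (matA (familyPairs κ g c x t)).det ≠ 0) :
    momentAt2 κ g c x t + (1 / 2 : ℂ) • (momentAt κ g c x t * matJ * gramAt κ g c x t) =
      columns κ g x t * Matrix.diagonal κ * Matrix.diagonal κ * resolvent κ g c x t
        * (columns κ g x t)ᵀ := by
  simp only [momentAt2, momentAt, gramAt, gram, Matrix.mul_assoc]
  rw [← Matrix.mul_assoc (Matrix.diagonal κ) (resolvent κ g c x t) (columns κ g x t)ᵀ,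
    commutator_inverse (matA_mul_resolvent hdet) (resolvent_mul_matA hdet)
      (matA_commutator g c x t hκ)]
  simp only [Matrix.add_mul, Matrix.mul_add, Matrix.smul_mul, Matrix.mul_smul, Matrix.mul_assoc]

theorem hasEntryDerivAt_momentAt_x (hκ : Function.Injective κ) (hΩ : IsOpen Ω)
    (hg : ∀ i, IsLaxFamily Ω lam q φ (κ i) (g i)) (hxt : (x, t) ∈ Ω)
    (hdet : (matA (familyPairs κ g c x t)).det ≠ 0) :
    HasEntryDerivAt (fun y => momentAt κ g c y t)
      (-(pauli3 * (momentAt2 κ g c x t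
            + (1 / 2 : ℂ) • (momentAt κ g c x t * matJ * gramAt κ g c x t)))
        + potential (q x t) (-conj (q x t)) * momentAt κ g c x t
        - (1 / 2 : ℂ) • (momentAt κ g c x t * pauli1 * gramAt κ g c x t)
        - momentAt2 κ g c x t * pauli3
        + momentAt κ g c x t * (potential (q x t) (-conj (q x t)))ᵀ) x := by
  have hG := hasEntryDerivAt_columns_x hg hxt
  refine (((hG.mul_const _).mul (hasEntryDerivAt_resolvent_x (c := c) hκ hΩ hg hxt hdet)).mul
    hG.transpose).congr_deriv ?_
  rw [moment_succ hκ hdet]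
  simp only [gramAt, gram, momentAt, momentAt2, Matrix.transpose_add,
    Matrix.transpose_neg, Matrix.transpose_mul,
    Matrix.diagonal_transpose, pauli3_transpose, Matrix.add_mul,
    Matrix.mul_add, Matrix.neg_mul, Matrix.mul_neg, Matrix.smul_mul,
    Matrix.mul_smul, Matrix.mul_assoc]
  module

theorem hasEntryDerivAt_potential {u v : ℝ → ℂ} {u' v' : ℂ} {s : ℝ} (hu : HasDerivAt u u' s)
    (hv : HasDerivAt v v' s) :
    HasEntryDerivAt (fun τ => potential (u τ) (v τ)) (potential u' v') s := by
  intro i j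
  fin_cases i <;> fin_cases j <;>
    first
      | exact hasDerivAt_const s (0 : ℂ)
      | exact hu
      | exact hv

theorem hasEntryDerivAt_gramDeriv_x (hκ : Function.Injective κ) (hΩ : IsOpen Ω)
    (hg : ∀ i, IsLaxFamily Ω lam q φ (κ i) (g i)) (hxt : (x, t) ∈ Ω)
    (hdet : (matA (familyPairs κ g c x t)).det ≠ 0) {qx : ℂ}
    (hq : HasDerivAt (fun y => q y t) qx x) :
    HasEntryDerivAt (fun y => gramDeriv (q y t) (-conj (q y t)) (gramAt κ g c y t)
        (momentAt κ g c y t))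
      (gramDeriv2 (q x t) (-conj (q x t)) qx (-conj qx) (gramAt κ g c x t) (momentAt κ g c x t)
        (momentAt2 κ g c x t)) x := by
  have hP := hasEntryDerivAt_potential hq hq.star.neg
  have hM := hasEntryDerivAt_momentAt_x (c := c) hκ hΩ hg hxt hdet
  have hQ := hasEntryDerivAt_gramAt_x (c := c) hκ hΩ hg hxt hdet
  refine (((((hM.const_mul pauli3).neg.sub (hM.transpose.mul_const pauli3)).add
    (hP.mul hQ)).add (hQ.mul hP.transpose)).sub
    (((hQ.mul_const pauli1).mul hQ).const_smul (1 / 2))).congr_deriv ?_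
  rfl

theorem hasEntryDerivAt_resolvent_t (hκ : Function.Injective κ) (hΩ : IsOpen Ω)
    (hg : ∀ i, IsLaxFamily Ω lam q φ (κ i) (g i)) (hne : ∀ i k, κ i ≠ doubleParam lam k)
    (hxt : (x, t) ∈ Ω) (hdet : (matA (familyPairs κ g c x t)).det ≠ 0)
    {c' : ι → ℂ} (hc : ∀ i, HasDerivAt (c i) (c' i) t) :
    HasEntryDerivAt (fun τ => resolvent κ g c x τ)
      (-(resolvent κ g c x t
        * matAFlow (q x t) (-conj (q x t)) (columns κ g x t) (Matrix.diagonal κ)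
          (Matrix.diagonal c') (signMat m)
          (cauchyMat κ (doubleParam lam) (columns κ g x t) (sourceMat φ x t))
        * resolvent κ g c x t)) t :=
  (hasEntryDerivAt_matA_t hκ hΩ hg hne hxt hc).inv hdet

/-- The dressed old sources `φ_j`, `S₋ φ_j` as columns of a matrix. -/
def dressedSourceMat (κ : ι → ℂ) (g : ι → ℂ → ℝ → ℝ → Vec2) (c : ι → ℝ → ℂ) (lam : Fin m → ℂ)
    (φ : Fin m → ℝ → ℝ → Vec2) (x t : ℝ) : Matrix (Fin 2) (Fin m × Bool) ℂ :=
  sourceMat φ x t - columns κ g x t * resolvent κ g c x t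
    * cauchyMat κ (doubleParam lam) (columns κ g x t) (sourceMat φ x t)

theorem hasEntryDerivAt_gramAt_t (hκ : Function.Injective κ) (hΩ : IsOpen Ω)
    (hg : ∀ i, IsLaxFamily Ω lam q φ (κ i) (g i)) (hne : ∀ i k, κ i ≠ doubleParam lam k)
    (hxt : (x, t) ∈ Ω) (hdet : (matA (familyPairs κ g c x t)).det ≠ 0)
    {c' : ι → ℂ} (hc : ∀ i, HasDerivAt (c i) (c' i) t) :
    HasEntryDerivAt (fun τ => gramAt κ g c x τ)
      (Complex.I • gramFlow (q x t) (-conj (q x t)) (deriv (fun y => q y t) x)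
          (-conj (deriv (fun y => q y t) x)) (gramAt κ g c x t) (momentAt κ g c x t)
          (momentAt2 κ g c x t)
        + sourceMat φ x t * signMat m * (sourceMat φ x t)ᵀ
        - dressedSourceMat κ g c lam φ x t * signMat m * (dressedSourceMat κ g c lam φ x t)ᵀ
        - dressedColumns κ g c x t * Matrix.diagonal c' * (dressedColumns κ g c x t)ᵀ) t := by
  have hG := hasEntryDerivAt_columns_t hg hxt
  refine ((hG.mul (hasEntryDerivAt_resolvent_t (c := c) hκ hΩ hg hne hxt hdet hc)).mul
    hG.transpose).congr_deriv ?_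
  exact gram_flow (matA_mul_resolvent hdet) (resolvent_mul_matA hdet)
    (resolvent_transpose hκ) (Matrix.diagonal_transpose κ) (matA_commutator g c x t hκ) _ _ _ _ _
    _ (Matrix.diagonal_transpose _) _

theorem matJ_transpose : matJᵀ = -matJ := by
  rw [matJ, transpose_of_fin_two]
  ext i j; fin_cases i <;> fin_cases j <;> simp

/-- The bilinear form of two dressed vectors. -/
theorem dressed_form_commutator {ι S p : Type} [Fintype ι] [DecidableEq ι] [Fintype S]
    {G : Matrix (Fin 2) ι ℂ} {A R K : Matrix ι ι ℂ} (hAR : A * R = 1) (hRA : R * A = 1)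
    (hR : Rᵀ = R) (hKt : Kᵀ = K) (hK : K * A - A * K = -((1 / 2 : ℂ) • (Gᵀ * matJ * G)))
    {W : Matrix (Fin 2) S ℂ} {Z : Matrix S S ℂ} (hZt : Zᵀ = Z) {B : Matrix ι S ℂ}
    (hB : K * B - B * Z = -((1 / 2 : ℂ) • (Gᵀ * matJ * W))) {z : ℂ}
    {ψ : Matrix (Fin 2) p ℂ} {b : Matrix ι p ℂ} {v : Matrix S p ℂ}
    (hb : K * b - z • b = -((1 / 2 : ℂ) • (Gᵀ * matJ * ψ)))
    (hv : Z * v - z • v = -((1 / 2 : ℂ) • (Wᵀ * matJ * ψ))) :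
    Z * (v - Bᵀ * R * b) - z • (v - Bᵀ * R * b) =
      -((1 / 2 : ℂ) • ((W - G * R * B)ᵀ * matJ * (ψ - G * R * b))) := by
  have h1 := commutator_coords hAR hRA hR hK hb
  have h2 := congrArg Matrix.transpose hB
  simp only [Matrix.transpose_sub, Matrix.transpose_neg, Matrix.transpose_smul,
    Matrix.transpose_mul, Matrix.transpose_transpose, hKt, hZt, matJ_transpose,
    Matrix.neg_mul, Matrix.mul_neg, smul_neg, neg_neg] at h2
  have h3 : Z * Bᵀ = Bᵀ * K - (1 / 2 : ℂ) • (Wᵀ * (matJ * G)) := by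
    rw [← h2]; abel
  have h4 : Z * v = z • v - (1 / 2 : ℂ) • (Wᵀ * (matJ * ψ)) := by
    rw [sub_eq_iff_eq_add] at hv
    rw [hv, Matrix.mul_assoc]; abel
  have h5 : Z * (Bᵀ * (R * b)) =
      Bᵀ * (K * (R * b)) - (1 / 2 : ℂ) • (Wᵀ * (matJ * (G * (R * b)))) := by
    rw [← Matrix.mul_assoc, h3]
    simp only [Matrix.sub_mul, Matrix.smul_mul, Matrix.mul_assoc]
  simp only [Matrix.transpose_mul, hR, Matrix.mul_assoc] at h1
  simp only [Matrix.transpose_sub, Matrix.transpose_mul, hR, Matrix.mul_sub, Matrix.sub_mul,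
    Matrix.mul_smul, Matrix.mul_assoc, h4, h5, h1]
  module

/-- Separates the polynomial part of the flow, which `dressed_vector_t` transforms, from the source
part in its factored form. -/
theorem replicateCol_laxT {S : Type} [Fintype S] [DecidableEq S] (e ζ : S → ℂ)
    (W : Matrix (Fin 2) S ℂ) (q r qx rx z : ℂ) (ψ : Vec2) :
    Matrix.replicateCol Unit (laxT e ζ (fun k => Wᵀ k) q r qx rx z *ᵥ ψ) =
      laxV z q r qx rx * Matrix.replicateCol Unit ψ
        + W * Matrix.diagonal e * cauchyMat ζ (fun _ => z) W (Matrix.replicateCol Unit ψ) := by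
  ext a u
  rw [Matrix.add_apply, ← sum_smul_sourceH_mulVec, ← replicateCol_mulVec]
  simp only [Matrix.replicateCol_apply, laxT, Matrix.add_mulVec, Pi.add_apply]
  rfl

/-- Beyond `dressed_vector_t`, it remains to recognise v - BᵀRb and Rb as pairings with the dressed
vector. The first reproduces the old sources in dressed form; the second makes the columns of G R
appear as sources with weights `c'`. -/
theorem hasEntryDerivAt_dressedCol_t (hκ : Function.Injective κ) (hΩ : IsOpen Ω)
    (hg : ∀ i, IsLaxFamily Ω lam q φ (κ i) (g i)) (hne : ∀ i k, κ i ≠ doubleParam lam k)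
    (hxt : (x, t) ∈ Ω) (hdet : (matA (familyPairs κ g c x t)).det ≠ 0)
    {c' : ι → ℂ} (hc : ∀ i, HasDerivAt (c i) (c' i) t) {z : ℂ} (hz : ∀ i, κ i ≠ z)
    (hzne : ∀ k, z ≠ doubleParam lam k) (hζ : ∀ k, doubleParam lam k ≠ z) {ψ : ℝ → ℝ → Vec2}
    (hψ : HasDerivAt (fun τ => ψ x τ) (laxT doubleSign (doubleParam lam)
      (doubleVec fun j => φ j x t) (q x t) (-conj (q x t)) (deriv (fun y => q y t) x)
      (-conj (deriv (fun y => q y t) x)) z *ᵥ ψ x t) t) :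
    HasEntryDerivAt (fun τ => dressedCol κ g c z ψ x τ)
      (laxV z (q x t - gramAt κ g c x t 0 0) (-conj (q x t) - gramAt κ g c x t 1 1)
          (deriv (fun y => q y t) x - gramDeriv (q x t) (-conj (q x t)) (gramAt κ g c x t)
            (momentAt κ g c x t) 0 0)
          (-conj (deriv (fun y => q y t) x) - gramDeriv (q x t) (-conj (q x t))
            (gramAt κ g c x t) (momentAt κ g c x t) 1 1) * dressedCol κ g c z ψ x t
        + dressedSourceMat κ g c lam φ x t * signMat m
          * cauchyMat (doubleParam lam) (fun _ => z) (dressedSourceMat κ g c lam φ x t)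
            (dressedCol κ g c z ψ x t)
        + dressedColumns κ g c x t * Matrix.diagonal c'
          * cauchyMat κ (fun _ => z) (dressedColumns κ g c x t) (dressedCol κ g c z ψ x t)) t := by
  have hAR := matA_mul_resolvent hdet
  have hRA := resolvent_mul_matA hdet
  have hR := resolvent_transpose (g := g) (c := c) (x := x) (t := t) hκ
  have hK := matA_commutator g c x t hκ
  have hb : Matrix.diagonal κ * sigmaCol κ g z ψ x t - z • sigmaCol κ g z ψ x t = _ :=
    cauchyMat_commutator_const _ _ hz
  have h1 := (hasEntryDerivAt_replicateCol hψ).sub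
    (((hasEntryDerivAt_columns_t hg hxt).mul
      (hasEntryDerivAt_resolvent_t (c := c) hκ hΩ hg hne hxt hdet hc)).mul
      (hasEntryDerivAt_sigmaCol_t hz hg hne hzne hxt hψ))
  refine h1.congr_deriv ?_
  -- Both sides solve the same Sylvester equation, by `commutator_coords`; its solution is unique
  -- because z differs from every κ.
  have hcoord : resolvent κ g c x t * sigmaCol κ g z ψ x t =
      cauchyMat κ (fun _ => z) (dressedColumns κ g c x t) (dressedCol κ g c z ψ x t) := by
    refine eq_cauchyMat (fun i _ => hz i) ?_
    rw [← Matrix.smul_eq_mul_diagonal _ z, commutator_coords hAR hRA hR hK hb, dressedColumns,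
      dressedCol, sub_sub_cancel_left]
    simp only [Matrix.mul_assoc]
  have hv : cauchyMat (doubleParam lam) (fun _ => z) (sourceMat φ x t)
        (Matrix.replicateCol Unit (ψ x t))
      - (cauchyMat κ (doubleParam lam) (columns κ g x t) (sourceMat φ x t))ᵀ
        * resolvent κ g c x t * sigmaCol κ g z ψ x t =
      cauchyMat (doubleParam lam) (fun _ => z) (dressedSourceMat κ g c lam φ x t)
        (dressedCol κ g c z ψ x t) := by
    refine eq_cauchyMat (fun k _ => hζ k) ?_
    rw [← Matrix.smul_eq_mul_diagonal _ z]
    exact dressed_form_commutator hAR hRA hR (Matrix.diagonal_transpose κ) hK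
      (Matrix.diagonal_transpose _) (cauchyMat_commutator _ _ hne) hb
      (cauchyMat_commutator_const _ _ hζ)
  have h2 := replicateCol_laxT doubleSign (doubleParam lam) (sourceMat φ x t) (q x t)
    (-conj (q x t)) (deriv (fun y => q y t) x) (-conj (deriv (fun y => q y t) x)) z (ψ x t)
  rw [← hv, ← hcoord]
  change Matrix.replicateCol Unit (laxT doubleSign (doubleParam lam)
    (fun k => (sourceMat φ x t)ᵀ k) (q x t) (-conj (q x t)) (deriv (fun y => q y t) x)
    (-conj (deriv (fun y => q y t) x)) z *ᵥ ψ x t) - _ = _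
  rw [h2, laxV_eq, laxV_eq, Matrix.smul_mul, Matrix.smul_mul]
  exact dressed_vector_t hAR hRA hR (Matrix.diagonal_transpose κ) hK _ _ _ _ _ _ _ _ hb

end DressedDerivatives

/-! ### The involution S₋ and the reduction r = -q* -/

section Involution

theorem sMinus_sMinus (v : Vec2) : sMinus (sMinus v) = -v := by
  ext k; fin_cases k <;> simp [sMinus]

theorem sMinus_add (v w : Vec2) : sMinus (v + w) = sMinus v + sMinus w := by
  ext k; fin_cases k <;> simp [sMinus]; ring

theorem sMinus_smul (a : ℂ) (v : Vec2) : sMinus (a • v) = conj a • sMinus v := by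
  ext k; fin_cases k <;> simp [sMinus]

theorem wronskian_sMinus (v w : Vec2) :
    wronskian (sMinus v) (sMinus w) = conj (wronskian v w) := by
  simp [wronskian, sMinus]; ring

theorem wronskian_sMinus_left (v w : Vec2) :
    wronskian (sMinus v) w = -conj (wronskian v (sMinus w)) := by
  simp [wronskian, sMinus]; ring

theorem sourceH_neg (v : Vec2) : sourceH (-v) = sourceH v := by
  simp [sourceH]

theorem sourceH_smul (a : ℂ) (v : Vec2) : sourceH (a • v) = a ^ 2 • sourceH v := by
  ext i j; fin_cases i <;> fin_cases j <;> simp [sourceH] <;> ring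

theorem sMinus_sourceH_mulVec (w v : Vec2) :
    sMinus (sourceH w *ᵥ v) = sourceH (sMinus w) *ᵥ sMinus v := by
  rw [sourceH_mulVec, sourceH_mulVec, sMinus_smul, wronskian_sMinus]
  simp [map_ofNat (starRingEnd ℂ) 2]

theorem sMinus_laxU_mulVec (z q : ℂ) (v : Vec2) :
    sMinus (laxU z q (-conj q) *ᵥ v) = laxU (-conj z) q (-conj q) *ᵥ sMinus v := by
  ext k
  fin_cases k <;> simp [sMinus, laxU, Matrix.mulVec, dotProduct, Fin.sum_univ_two] <;>
    ring

theorem sMinus_laxV_mulVec (z q qx : ℂ) (v : Vec2) :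
    sMinus (laxV z q (-conj q) qx (-conj qx) *ᵥ v) =
      laxV (-conj z) q (-conj q) qx (-conj qx) *ᵥ sMinus v := by
  ext k
  fin_cases k <;>
    simp [sMinus, laxV, Matrix.mulVec, dotProduct, Fin.sum_univ_two,
      map_ofNat (starRingEnd ℂ) 2] <;> ring

/-- `S₋` as a real continuous linear map. -/
def sMinusCLM : Vec2 →L[ℝ] Vec2 :=
  LinearMap.toContinuousLinearMap
    { toFun := sMinus
      map_add' := sMinus_add
      map_smul' := fun a v => by
        ext k; fin_cases k <;> simp [sMinus] }

theorem hasDerivAt_sMinus {ψ : ℝ → Vec2} {ψ' : Vec2} {s : ℝ} (h : HasDerivAt ψ ψ' s) :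
    HasDerivAt (fun τ => sMinus (ψ τ)) (sMinus ψ') s :=
  sMinusCLM.hasFDerivAt.comp_hasDerivAt s h

theorem hasDerivAt_sMinus_conj {f : ℂ → Vec2} {f' : Vec2} {z : ℂ}
    (h : HasDerivAt f f' (-conj z)) :
    HasDerivAt (fun w => sMinus (f (-conj w))) (-sMinus f') z := by
  rw [hasDerivAt_pi] at h ⊢
  have key : ∀ k, HasDerivAt (fun w => conj (f (-conj w) k)) (-conj (f' k)) z := fun k => by
    have h1 : HasDerivAt (fun w => f (-w) k) (-f' k) (conj z) := by
      simpa [Function.comp_def] using (h k).comp (conj z) (hasDerivAt_neg (conj z))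
    simpa [Function.comp_def] using h1.conj_conj
  intro k
  fin_cases k
  · simpa [sMinus] using (key 1).fun_neg
  · simpa [sMinus] using key 0

variable {m N : ℕ} {Ω : Set (ℝ × ℝ)} {lam : Fin m → ℂ} {q : ℝ → ℝ → ℂ}
  {φ : Fin m → ℝ → ℝ → Vec2}

/-- S₋ intertwines each Lax matrix at z with the one at -z*. On the source part it exchanges the two
poles of a pair, and S₋² = -1 does no harm since H is even. -/
theorem IsLaxSolution.sMinus {z : ℂ} {ψ : ℝ → ℝ → Vec2} (h : IsLaxSolution Ω lam q φ z ψ) :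
    IsLaxSolution Ω lam q φ (-conj z) fun x t => NLSMinus.sMinus (ψ x t) := by
  intro x t hxt
  obtain ⟨hx, ht⟩ := h x t hxt
  refine ⟨(hasDerivAt_sMinus hx).congr_deriv (sMinus_laxU_mulVec _ _ _),
    (hasDerivAt_sMinus ht).congr_deriv ?_⟩
  rw [Matrix.add_mulVec, sMinus_add, sMinus_laxV_mulVec, Matrix.add_mulVec, Matrix.sum_mulVec,
    Matrix.sum_mulVec]
  congr 1
  have hsum : ∀ u : Fin m → Vec2, NLSMinus.sMinus (∑ j, u j) = ∑ j, NLSMinus.sMinus (u j) :=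
    fun u => map_sum sMinusCLM u Finset.univ
  rw [hsum]
  refine Finset.sum_congr rfl fun j _ => ?_
  have h1 : ∀ a b : Vec2, NLSMinus.sMinus (a - b) = NLSMinus.sMinus a - NLSMinus.sMinus b :=
    fun a b => map_sub sMinusCLM a b
  simp only [Matrix.sub_mulVec, Matrix.smul_mulVec, h1, sMinus_smul, sMinus_sourceH_mulVec,
    sMinus_sMinus, sourceH_neg]
  have h2 : conj (1 / (z - lam j)) = -(1 / (-conj z + conj (lam j))) := by
    rw [← one_div_neg_eq_neg_one_div]; simp [neg_add_eq_sub]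
  have h3 : conj (1 / (z + conj (lam j))) = -(1 / (-conj z - lam j)) := by
    rw [← one_div_neg_eq_neg_one_div]; simp [add_comm]
  rw [h2, h3]
  module

theorem IsLaxFamily.sMinus {μ : ℂ} {f : ℂ → ℝ → ℝ → Vec2} (h : IsLaxFamily Ω lam q φ μ f) :
    IsLaxFamily Ω lam q φ (-conj μ) fun z x t => NLSMinus.sMinus (f (-conj z) x t) := by
  obtain ⟨D, hD, hμ, hcd, hhol, hlax⟩ := h
  have hcont : Continuous fun z : ℂ => -conj z := by fun_prop
  refine ⟨(fun z => -conj z) ⁻¹' D, hD.preimage hcont, by simpa using hμ, ?_, ?_, ?_⟩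
  · refine sMinusCLM.contDiff.comp_contDiffOn
      (hcd.comp (f := fun p : ℂ × ℝ × ℝ => (-conj p.1, p.2)) ?_ fun p hp => ⟨hp.1, hp.2⟩)
    refine ContDiff.contDiffOn (ContDiff.prodMk (ContDiff.neg ?_) contDiff_snd)
    exact Complex.conjCLE.contDiff.comp contDiff_fst
  · intro x t hxt z hz
    have h1 := ((hhol x t hxt).differentiableAt (hD.mem_nhds hz)).hasDerivAt
    exact (hasDerivAt_sMinus_conj h1).differentiableAt.differentiableWithinAt
  · intro z hz
    simpa using (hlax _ hz).sMinus

/-- The doubled list of families `f_j`, `S₋ f_j`. -/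
def doubleFamily (f : Fin N → ℂ → ℝ → ℝ → Vec2) : Fin N × Bool → ℂ → ℝ → ℝ → Vec2
  | (j, false) => f j
  | (j, true) => fun z x t => sMinus (f j (-conj z) x t)

/-- The doubled list of coefficients `c_j`, `-c_j*`. -/
def doubleCoef (c : Fin N → ℝ → ℂ) : Fin N × Bool → ℝ → ℂ
  | (j, false) => c j
  | (j, true) => fun t => -conj (c j t)

theorem pairs_eq (mu : Fin N → ℂ) (f : Fin N → ℂ → ℝ → ℝ → Vec2) (c : Fin N → ℝ → ℂ) (x t : ℝ) :
    pairs mu f c x t = familyPairs (doubleParam mu) (doubleFamily f) (doubleCoef c) x t := by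
  funext ⟨j, b⟩
  cases b <;> rfl

/-- The involution of the doubled index set. -/
def flip (N : ℕ) : Fin N × Bool ≃ Fin N × Bool :=
  (Equiv.refl _).prodCongr Equiv.boolNot

theorem doubleParam_flip (mu : Fin N → ℂ) (i : Fin N × Bool) :
    doubleParam mu (flip N i) = -conj (doubleParam mu i) := by
  obtain ⟨j, b⟩ := i
  cases b <;> simp [flip, doubleParam]

theorem doubleVec_flip (w : Fin N → Vec2) (i : Fin N × Bool) :
    doubleVec w (flip N i) = (doubleSign i : ℂ) • sMinus (doubleVec w i) := by
  obtain ⟨j, b⟩ := i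
  cases b <;> simp [flip, doubleVec, doubleSign, sMinus_sMinus]

theorem doubleSign_mul_self (i : Fin N × Bool) : (doubleSign i : ℂ) * doubleSign i = 1 := by
  obtain ⟨j, b⟩ := i
  cases b <;> simp [doubleSign]

theorem signMat_mul_self : signMat N * signMat N = 1 := by
  simp [signMat, Matrix.diagonal_mul_diagonal, doubleSign_mul_self]

theorem columns_double (mu : Fin N → ℂ) (f : Fin N → ℂ → ℝ → ℝ → Vec2) (x t : ℝ) :
    columns (doubleParam mu) (doubleFamily f) x t =
      Matrix.of fun a i => doubleVec (fun j => f j (mu j) x t) i a := by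
  ext a ⟨j, b⟩
  cases b <;> simp [columns, doubleParam, doubleFamily, doubleVec]

/-- Entrywise complex conjugation of a matrix. -/
def conjMat {l n : Type} (M : Matrix l n ℂ) : Matrix l n ℂ := M.map conj

theorem conjMat_mul {l m n : Type} [Fintype m] (A : Matrix l m ℂ) (B : Matrix m n ℂ) :
    conjMat (A * B) = conjMat A * conjMat B := Matrix.map_mul

theorem doubleVec_submatrix (w : Fin N → Vec2) :
    (Matrix.of fun a i => doubleVec w i a : Matrix (Fin 2) (Fin N × Bool) ℂ).submatrix id (flip N) =
      -(matJ * conjMat (Matrix.of fun a i => doubleVec w i a) * signMat N) := by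
  ext a i
  rw [signMat, Matrix.neg_apply, Matrix.mul_diagonal, Matrix.mul_apply, Fin.sum_univ_two]
  simp only [Matrix.submatrix_apply, Matrix.of_apply, doubleVec_flip, conjMat]
  fin_cases a <;> simp [matJ, sMinus, mul_comm]

/-- The sign is the derivative of the reflection -z*. Where `f` is not differentiable neither is its
reflection and both derivatives are zero by convention, so the symmetry of A needs no regularity. -/
theorem deriv_sMinus_conj (f : ℂ → Vec2) (z : ℂ) :
    deriv (fun w => sMinus (f (-conj w))) (-conj z) = -sMinus (deriv f z) := by
  by_cases h : DifferentiableAt ℂ f z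
  · exact (hasDerivAt_sMinus_conj (by simpa using h.hasDerivAt)).deriv
  · have h' : ¬DifferentiableAt ℂ (fun w => sMinus (f (-conj w))) (-conj z) := fun hd => h (by
      have h1 := (hasDerivAt_sMinus_conj (z := z) hd.hasDerivAt).differentiableAt.neg
      refine h1.congr_of_eventuallyEq (Filter.Eventually.of_forall fun w => ?_)
      simp [sMinus_sMinus])
    rw [deriv_zero_of_not_differentiableAt h, deriv_zero_of_not_differentiableAt h']
    ext k; fin_cases k <;> simp [sMinus]

theorem sigma_sMinus (g h : SpectralVector) :
    sigma g.sMinus h.sMinus = -conj (sigma g h) := by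
  have hg : ∀ g : SpectralVector, g.sMinus.value = NLSMinus.sMinus g.value := fun g => by
    simp [SpectralVector.value, SpectralVector.sMinus]
  by_cases he : g.param = h.param
  · rw [sigma_of_eq (g := g) he, sigma_of_eq (by simp [SpectralVector.sMinus, he]), hg]
    simp only [SpectralVector.sMinus, deriv_sMinus_conj]
    rw [show ∀ u v, wronskian u (-v) = -wronskian u v from fun u v => by simp [wronskian]; ring,
      wronskian_sMinus, map_div₀, map_ofNat, neg_div]
  · have he' : g.sMinus.param ≠ h.sMinus.param := fun h' => he (by
      simpa [SpectralVector.sMinus] using congrArg conj h')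
    rw [sigma_of_ne he, sigma_of_ne he', hg, hg, wronskian_sMinus]
    simp only [SpectralVector.sMinus, map_neg, map_div₀, map_mul, map_sub, map_ofNat]
    rw [neg_sub_neg, ← neg_sub (conj g.param), mul_neg, div_neg]

theorem sigma_sMinus_left {g h : SpectralVector} (hne : g.param ≠ -conj h.param) :
    sigma g.sMinus h = conj (sigma g h.sMinus) := by
  have hne' : g.sMinus.param ≠ h.param := fun h' => hne (by rw [← h']; simp [SpectralVector.sMinus])
  rw [sigma_of_ne hne', sigma_of_ne hne]
  have hg : ∀ g : SpectralVector, g.sMinus.value = NLSMinus.sMinus g.value := fun g => by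
    simp [SpectralVector.value, SpectralVector.sMinus]
  rw [hg, hg, wronskian_sMinus_left]
  simp only [SpectralVector.sMinus, map_neg, map_div₀, map_mul, map_sub, map_ofNat,
    Complex.conj_conj, neg_neg]
  rw [← neg_add', sub_neg_eq_add, mul_neg, div_neg, neg_div]

theorem signMat_transpose : (signMat N)ᵀ = signMat N := Matrix.diagonal_transpose _

theorem conjMat_one {n : Type} [DecidableEq n] : conjMat (1 : Matrix n n ℂ) = 1 :=
  Matrix.map_one _ (map_zero _) (map_one _)

variable {mu : Fin N → ℂ} (f : Fin N → ℂ → ℝ → ℝ → Vec2) (c : Fin N → ℝ → ℂ) (x t : ℝ)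

/-- Entries within one half satisfy σ(S₋g, S₋h) = -σ(g, h)*, and the coefficients c, -c* are chosen
to match. Entries between the halves satisfy σ(S₋g, h) = σ(g, S₋h)*; the sign matrices account for
the opposite sign. -/
theorem matA_double_submatrix (hmu : Function.Injective (doubleParam mu)) :
    (matA (pairs mu f c x t)).submatrix (flip N) (flip N) =
      -(signMat N * conjMat (matA (pairs mu f c x t)) * signMat N) := by
  have hne : ∀ j k, mu j ≠ -conj (mu k) := fun j k h => by
    have := @hmu (j, false) (k, true) h
    simp at this
  ext ⟨j, a⟩ ⟨k, b⟩
  rw [Matrix.neg_apply, signMat, Matrix.mul_diagonal, Matrix.diagonal_mul]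
  have key : ∀ g h : SpectralVector, sigma g.sMinus.sMinus h.sMinus.sMinus = sigma g h := by
    intro g h
    rw [sigma_sMinus, sigma_sMinus]; simp
  cases a <;> cases b
  · by_cases hjk : j = k <;>
      simp [matA, flip, pairs, conjMat, doubleSign, sigma_sMinus, hjk] <;> ring
  · simp [matA, flip, pairs, conjMat, doubleSign]
    exact sigma_sMinus_left (hne j k)
  · simp [matA, flip, pairs, conjMat, doubleSign]
    rw [sigma_sMinus_left (hne j k)]; simp
  · by_cases hjk : j = k <;>
      simp [matA, flip, pairs, conjMat, doubleSign, sigma_sMinus, hjk] <;> ring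

variable {f c x t}

theorem resolvent_double_submatrix (hmu : Function.Injective (doubleParam mu))
    (hdet : (matA (familyPairs (doubleParam mu) (doubleFamily f) (doubleCoef c) x t)).det ≠ 0) :
    (resolvent (doubleParam mu) (doubleFamily f) (doubleCoef c) x t).submatrix (flip N) (flip N) =
      -(signMat N * conjMat (resolvent (doubleParam mu) (doubleFamily f) (doubleCoef c) x t)
        * signMat N) := by
  have hAR := congrArg conjMat (matA_mul_resolvent hdet)
  rw [conjMat_mul, conjMat_one] at hAR
  have h1 := matA_double_submatrix f c x t hmu
  rw [pairs_eq] at h1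
  rw [resolvent, ← Matrix.inv_submatrix_equiv, h1]
  refine Matrix.inv_eq_right_inv ?_
  have h2 : ∀ X Y : Matrix (Fin N × Bool) (Fin N × Bool) ℂ, X * Y = 1 →
      -(signMat N * X * signMat N) * -(signMat N * Y * signMat N) = 1 := fun X Y hXY => by
    rw [neg_mul_neg]
    calc signMat N * X * signMat N * (signMat N * Y * signMat N)
        = signMat N * (X * (signMat N * signMat N) * Y) * signMat N := by
          simp only [Matrix.mul_assoc]
      _ = 1 := by rw [signMat_mul_self, Matrix.mul_one, hXY, Matrix.mul_one, signMat_mul_self]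
  exact h2 _ _ hAR

/-- A has even size, so the overall minus sign drops out of the determinant, and the two sign
matrices cancel. -/
theorem conj_Delta (hmu : Function.Injective (doubleParam mu)) :
    conj (Delta mu f c x t) = Delta mu f c x t := by
  have h1 := congrArg Matrix.det (matA_double_submatrix f c x t hmu)
  have h2 : (signMat N).det * (signMat N).det = 1 := by
    rw [← Matrix.det_mul, signMat_mul_self, Matrix.det_one]
  have h3 : (conjMat (matA (pairs mu f c x t))).det = conj (matA (pairs mu f c x t)).det :=
    (RingHom.map_det (starRingEnd ℂ) _).symm
  rw [Matrix.det_submatrix_equiv_self, Matrix.det_neg, Matrix.det_mul, Matrix.det_mul, h3,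
    Fintype.card_prod, Fintype.card_bool, mul_comm _ 2, pow_mul, neg_one_sq, one_pow, one_mul,
    mul_right_comm, h2, one_mul] at h1
  exact h1.symm

theorem columns_double_submatrix :
    (columns (doubleParam mu) (doubleFamily f) x t).submatrix id (flip N) =
      -(matJ * conjMat (columns (doubleParam mu) (doubleFamily f) x t) * signMat N) := by
  rw [columns_double, doubleVec_submatrix]

/-- The minus signs of G and of its resolvent cancel, so the dressed columns transform with the sign
opposite to that of the columns themselves. -/
theorem dressedColumns_double_submatrix (hmu : Function.Injective (doubleParam mu))
    (hdet : (matA (familyPairs (doubleParam mu) (doubleFamily f) (doubleCoef c) x t)).det ≠ 0) :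
    (dressedColumns (doubleParam mu) (doubleFamily f) (doubleCoef c) x t).submatrix id (flip N) =
      matJ * conjMat (dressedColumns (doubleParam mu) (doubleFamily f) (doubleCoef c) x t)
        * signMat N := by
  rw [dressedColumns, ← Matrix.submatrix_mul_equiv _ _ id (flip N) (flip N),
    columns_double_submatrix, resolvent_double_submatrix hmu hdet, conjMat_mul, Matrix.neg_mul,
    Matrix.mul_neg, neg_neg]
  calc _ = matJ * conjMat (columns (doubleParam mu) (doubleFamily f) x t)
        * (signMat N * signMat N) * conjMat (resolvent (doubleParam mu) (doubleFamily f)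
          (doubleCoef c) x t) * signMat N := by simp only [Matrix.mul_assoc]
    _ = _ := by rw [signMat_mul_self]; simp only [Matrix.mul_assoc, Matrix.one_mul]

theorem gramAt_double (hmu : Function.Injective (doubleParam mu))
    (hdet : (matA (familyPairs (doubleParam mu) (doubleFamily f) (doubleCoef c) x t)).det ≠ 0) :
    gramAt (doubleParam mu) (doubleFamily f) (doubleCoef c) x t =
      matJ * conjMat (gramAt (doubleParam mu) (doubleFamily f) (doubleCoef c) x t) * matJ := by
  have h1 : gramAt (doubleParam mu) (doubleFamily f) (doubleCoef c) x t =
      (dressedColumns (doubleParam mu) (doubleFamily f) (doubleCoef c) x t).submatrix id (flip N)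
        * ((columns (doubleParam mu) (doubleFamily f) x t).submatrix id (flip N))ᵀ := by
    rw [Matrix.transpose_submatrix, Matrix.submatrix_mul_equiv, Matrix.submatrix_id_id]
    rfl
  have h2 : conjMat (gramAt (doubleParam mu) (doubleFamily f) (doubleCoef c) x t) =
      conjMat (dressedColumns (doubleParam mu) (doubleFamily f) (doubleCoef c) x t)
        * (conjMat (columns (doubleParam mu) (doubleFamily f) x t))ᵀ := conjMat_mul _ _
  rw [h2]
  conv_lhs => rw [h1, dressedColumns_double_submatrix hmu hdet, columns_double_submatrix]
  simp only [Matrix.transpose_neg, Matrix.transpose_mul, signMat_transpose, matJ_transpose,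
    Matrix.mul_neg, neg_neg]
  calc _ = matJ * conjMat (dressedColumns (doubleParam mu) (doubleFamily f) (doubleCoef c) x t)
        * (signMat N * signMat N) * (conjMat (columns (doubleParam mu) (doubleFamily f) x t))ᵀ
        * matJ := by simp only [Matrix.mul_assoc]
    _ = _ := by rw [signMat_mul_self]; simp only [Matrix.mul_assoc, Matrix.one_mul]

theorem gramAt_double_one_one (hmu : Function.Injective (doubleParam mu))
    (hdet : (matA (familyPairs (doubleParam mu) (doubleFamily f) (doubleCoef c) x t)).det ≠ 0) :
    gramAt (doubleParam mu) (doubleFamily f) (doubleCoef c) x t 1 1 =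
      -conj (gramAt (doubleParam mu) (doubleFamily f) (doubleCoef c) x t 0 0) := by
  conv_lhs => rw [gramAt_double hmu hdet]
  simp only [Matrix.mul_apply, Fin.sum_univ_two, conjMat, Matrix.map_apply]
  simp [matJ]

variable {m : ℕ} {lam : Fin m → ℂ} {φ : Fin m → ℝ → ℝ → Vec2}

theorem cauchyMat_double_submatrix {mu : Fin N → ℂ} {ζ : Fin m → ℂ} (v : Fin N → Vec2)
    (w : Fin m → Vec2) :
    (cauchyMat (doubleParam mu) (doubleParam ζ) (Matrix.of fun a i => doubleVec v i a)
        (Matrix.of fun a i => doubleVec w i a)).submatrix (flip N) (flip m) =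
      -(signMat N * conjMat (cauchyMat (doubleParam mu) (doubleParam ζ)
        (Matrix.of fun a i => doubleVec v i a) (Matrix.of fun a i => doubleVec w i a))
        * signMat m) := by
  ext i k
  rw [Matrix.neg_apply, signMat, signMat, Matrix.mul_diagonal, Matrix.diagonal_mul]
  simp only [Matrix.submatrix_apply, cauchyMat, Matrix.of_apply, conjMat, Matrix.map_apply,
    doubleParam_flip]
  change -wronskian (doubleVec v (flip N i)) (doubleVec w (flip m k)) / _ =
    -(doubleSign i * conj (-wronskian (doubleVec v i) (doubleVec w k) / _) * doubleSign k)
  have h1 : ∀ (a b : ℂ) (u u' : Vec2), wronskian (a • u) (b • u') = a * b * wronskian u u' :=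
    fun a b u u' => by simp [wronskian]; ring
  rw [doubleVec_flip, doubleVec_flip, h1, wronskian_sMinus]
  simp only [map_neg, map_div₀, map_mul, map_sub, map_ofNat]
  rw [neg_sub_neg, ← neg_sub (conj (doubleParam mu i)), mul_neg, div_neg]
  ring

/-- The plus sign of the dressed columns meets the minus sign of the Cauchy matrix, so the
correction has the same symmetry as the sources: dressing commutes with S₋. -/
theorem dressedSourceMat_double_submatrix (hmu : Function.Injective (doubleParam mu))
    (hdet : (matA (familyPairs (doubleParam mu) (doubleFamily f) (doubleCoef c) x t)).det ≠ 0) :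
    (dressedSourceMat (doubleParam mu) (doubleFamily f) (doubleCoef c) lam φ x t).submatrix
        id (flip m) =
      -(matJ * conjMat (dressedSourceMat (doubleParam mu) (doubleFamily f) (doubleCoef c) lam φ
        x t) * signMat m) := by
  have h1 := dressedColumns_double_submatrix hmu hdet
  have h2 : (cauchyMat (doubleParam mu) (doubleParam lam)
        (columns (doubleParam mu) (doubleFamily f) x t) (sourceMat φ x t)).submatrix
          (flip N) (flip m) =
      -(signMat N * conjMat (cauchyMat (doubleParam mu) (doubleParam lam)
        (columns (doubleParam mu) (doubleFamily f) x t) (sourceMat φ x t)) * signMat m) := by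
    rw [columns_double]
    exact cauchyMat_double_submatrix _ _
  have h3 : (sourceMat φ x t).submatrix id (flip m) =
      -(matJ * conjMat (sourceMat φ x t) * signMat m) := doubleVec_submatrix _
  have h4 : dressedSourceMat (doubleParam mu) (doubleFamily f) (doubleCoef c) lam φ x t =
      sourceMat φ x t - dressedColumns (doubleParam mu) (doubleFamily f) (doubleCoef c) x t
        * cauchyMat (doubleParam mu) (doubleParam lam)
          (columns (doubleParam mu) (doubleFamily f) x t) (sourceMat φ x t) := rfl
  have h5 : ∀ A B : Matrix (Fin 2) (Fin m × Bool) ℂ, conjMat (A - B) = conjMat A - conjMat B :=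
    fun A B => by ext i j; simp [conjMat]
  rw [h4, h5, conjMat_mul, Matrix.submatrix_sub, Pi.sub_apply, Pi.sub_apply,
    ← Matrix.submatrix_mul_equiv _ _ id (flip N) (flip m), h1, h2, h3]
  have h6 : ∀ (X : Matrix (Fin 2) (Fin N × Bool) ℂ) (Y : Matrix (Fin N × Bool) (Fin m × Bool) ℂ),
      matJ * X * signMat N * -(signMat N * Y * signMat m) = -(matJ * (X * Y) * signMat m) :=
    fun X Y => by
      calc _ = -(matJ * X * (signMat N * signMat N) * Y * signMat m) := by
            simp only [Matrix.mul_assoc, Matrix.mul_neg]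
        _ = _ := by rw [signMat_mul_self]; simp only [Matrix.mul_assoc, Matrix.one_mul]
  rw [h6, Matrix.mul_sub, Matrix.sub_mul]
  abel

end Involution

/-! ### The transformed solution in terms of the dressing -/

section Transformed

variable {m N : ℕ} {Ω : Set (ℝ × ℝ)} {lam : Fin m → ℂ} {mu : Fin N → ℂ} {q : ℝ → ℝ → ℂ}
  {φ : Fin m → ℝ → ℝ → Vec2} {f : Fin N → ℂ → ℝ → ℝ → Vec2} {c s : Fin N → ℝ → ℂ} {x t : ℝ}

theorem Delta_eq : Delta mu f c x t =
    (matA (familyPairs (doubleParam mu) (doubleFamily f) (doubleCoef c) x t)).det := by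
  rw [Delta, formW0, pairs_eq]

theorem barQ_eq (hΔ : Delta mu f c x t ≠ 0) : barQ mu f c q x t =
    q x t - gramAt (doubleParam mu) (doubleFamily f) (doubleCoef c) x t 0 0 := by
  rw [Delta_eq] at hΔ
  rw [barQ, formW2, Delta_eq, pairs_eq, det_bordered hΔ, zero_sub, ← sub_eq_add_neg, gramAt, gram,
    Matrix.mul_assoc]
  rfl

theorem barVec_eq (hΔ : Delta mu f c x t ≠ 0) {z : ℂ} (hz : ∀ i, doubleParam mu i ≠ z)
    (ψ : ℝ → ℝ → Vec2) (k : Fin 2) : barVec mu f c z ψ x t k =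
      dressedCol (doubleParam mu) (doubleFamily f) (doubleCoef c) z ψ x t k () := by
  rw [Delta_eq] at hΔ
  rw [barVec, Pi.smul_apply, smul_eq_mul, formW1, Delta_eq, pairs_eq, det_bordered hΔ, dressedCol,
    Matrix.sub_apply, Matrix.mul_assoc]
  congr 1
  have h1 : (fun i => sigma (familyPairs (doubleParam mu) (doubleFamily f) (doubleCoef c) x t i).vec
      ⟨z, fun _ => ψ x t⟩) =
      fun i => sigmaCol (doubleParam mu) (doubleFamily f) z ψ x t i () :=
    funext fun i => (sigmaCol_apply hz ψ x t i ()).symm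
  rw [h1]
  rfl

/-- The column σ(g, f_j) is the column (j, false) of A minus c_j times a unit vector. Applying G A⁻¹
recovers f_j exactly, and what remains is c_j times a column of G A⁻¹; this explains the division by
c_j in the new source. -/
theorem newSource_eq (hΔ : Delta mu f c x t ≠ 0) {j : Fin N} (hc : c j t ≠ 0) :
    newSource mu f c s j x t = s j t •
      (dressedColumns (doubleParam mu) (doubleFamily f) (doubleCoef c) x t)ᵀ (j, false) := by
  have hΔ' := hΔ
  rw [Delta_eq] at hΔ'
  set P := familyPairs (doubleParam mu) (doubleFamily f) (doubleCoef c) x t with hP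
  ext k
  have h1 : (matA P).det⁻¹ * formW1 P (seed mu f x t j) k =
      c j t * dressedColumns (doubleParam mu) (doubleFamily f) (doubleCoef c) x t k (j, false) := by
    rw [formW1, det_bordered hΔ']
    have h2 : (fun i => sigma (P i).vec (seed mu f x t j)) =
        matA P *ᵥ Pi.single (j, false) 1 - c j t • Pi.single (j, false) 1 := by
      funext i
      rw [Matrix.mulVec_single_one]
      by_cases h : i = (j, false)
      · subst h
        simp [matA, hP, familyPairs, doubleCoef, doubleParam, doubleFamily, seed]
      · simp [matA, h, hP, familyPairs, doubleParam, doubleFamily, seed]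
    rw [h2, Matrix.mulVec_sub, Matrix.mulVec_mulVec,
      Matrix.nonsing_inv_mul (matA P) (isUnit_iff_ne_zero.2 hΔ'), Matrix.one_mulVec,
      Matrix.mulVec_smul, dotProduct_sub, dotProduct_smul, dotProduct_single_one,
      Matrix.mulVec_single_one, ← sub_add, smul_eq_mul]
    exact (congrArg (· + _) (sub_self _)).trans (zero_add _)
  rw [newSource, pairs_eq, Delta_eq, Pi.smul_apply, Pi.smul_apply, smul_eq_mul, smul_eq_mul,
    mul_inv, mul_assoc, mul_assoc, h1, inv_mul_cancel_left₀ hc]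
  rfl

theorem dressedSourceMat_column (hΔ : Delta mu f c x t ≠ 0)
    (hmu : Function.Injective (doubleParam mu))
    (hne : ∀ i k, doubleParam mu i ≠ doubleParam lam k) (k : Fin m × Bool) :
    (dressedSourceMat (doubleParam mu) (doubleFamily f) (doubleCoef c) lam φ x t)ᵀ k =
      doubleVec (fun j => barVec mu f c (lam j) (φ j) x t) k := by
  have h1 : ∀ j, (dressedSourceMat (doubleParam mu) (doubleFamily f) (doubleCoef c) lam φ x t)ᵀ
      (j, false) = barVec mu f c (lam j) (φ j) x t := fun j => by
    ext a
    rw [barVec_eq (z := lam j) hΔ (fun i => hne i (j, false))]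
    rfl
  obtain ⟨j, b⟩ := k
  cases b
  · exact h1 j
  · rw [Delta_eq] at hΔ
    change _ = sMinus (barVec mu f c (lam j) (φ j) x t)
    rw [← h1]
    have h2 := dressedSourceMat_double_submatrix (lam := lam) (φ := φ) hmu hΔ
    ext a
    have h3 := congrFun (congrFun h2 a) (j, false)
    rw [Matrix.neg_apply, signMat, Matrix.mul_diagonal, Matrix.mul_apply, Fin.sum_univ_two] at h3
    refine h3.trans ?_
    fin_cases a <;> simp [matJ, sMinus, conjMat, doubleSign]

theorem dressedColumns_true (hΔ : Delta mu f c x t ≠ 0)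
    (hmu : Function.Injective (doubleParam mu)) (j : Fin N) :
    (dressedColumns (doubleParam mu) (doubleFamily f) (doubleCoef c) x t)ᵀ (j, true) =
      -sMinus ((dressedColumns (doubleParam mu) (doubleFamily f) (doubleCoef c) x t)ᵀ
        (j, false)) := by
  rw [Delta_eq] at hΔ
  have h2 := dressedColumns_double_submatrix hmu hΔ
  ext a
  have h3 := congrFun (congrFun h2 a) (j, false)
  rw [signMat, Matrix.mul_diagonal, Matrix.mul_apply, Fin.sum_univ_two] at h3
  refine h3.trans ?_
  fin_cases a <;> simp [matJ, sMinus, conjMat, doubleSign]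

theorem isLaxFamily_double (hf : ∀ j, IsLaxFamily Ω lam q φ (mu j) (f j)) (i : Fin N × Bool) :
    IsLaxFamily Ω lam q φ (doubleParam mu i) (doubleFamily f i) := by
  obtain ⟨j, b⟩ := i
  cases b
  · exact hf j
  · exact (hf j).sMinus

/-- The derivatives of the doubled coefficients. -/
def doubleCoefDeriv (s : Fin N → ℝ → ℂ) (t : ℝ) : Fin N × Bool → ℂ
  | (j, false) => s j t ^ 2
  | (j, true) => -conj (s j t ^ 2)

theorem hasDerivAt_doubleCoef (hc : ∀ j, HasDerivAt (c j) (s j t ^ 2) t) (i : Fin N × Bool) :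
    HasDerivAt (doubleCoef c i) (doubleCoefDeriv s t i) t := by
  obtain ⟨j, b⟩ := i
  cases b
  · exact hc j
  · exact (hc j).star.fun_neg

theorem eventually_Delta_x (hmu : Function.Injective (doubleParam mu)) (hΩ : IsOpen Ω)
    (hf : ∀ j, IsLaxFamily Ω lam q φ (mu j) (f j)) (hxt : (x, t) ∈ Ω)
    (hΔ : Delta mu f c x t ≠ 0) : ∀ᶠ y in 𝓝 x, (y, t) ∈ Ω ∧ Delta mu f c y t ≠ 0 := by
  refine ((Continuous.prodMk_left t).continuousAt.eventually_mem (hΩ.mem_nhds hxt)).and ?_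
  simp only [Delta_eq] at hΔ ⊢
  exact (hasEntryDerivAt_matA_x hmu hΩ (isLaxFamily_double hf) hxt).det.continuousAt.eventually_ne
    hΔ

theorem eventually_Delta_t (hmu : Function.Injective (doubleParam mu))
    (hne : ∀ i k, doubleParam mu i ≠ doubleParam lam k) (hΩ : IsOpen Ω)
    (hf : ∀ j, IsLaxFamily Ω lam q φ (mu j) (f j)) (hxt : (x, t) ∈ Ω)
    (hc : ∀ j, HasDerivAt (c j) (s j t ^ 2) t)
    (hΔ : Delta mu f c x t ≠ 0) : ∀ᶠ τ in 𝓝 t, Delta mu f c x τ ≠ 0 := by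
  simp only [Delta_eq] at hΔ ⊢
  exact (hasEntryDerivAt_matA_t hmu hΩ (isLaxFamily_double hf) hne hxt
    (hasDerivAt_doubleCoef hc)).det.continuousAt.eventually_ne hΔ

theorem conj_barQ (hmu : Function.Injective (doubleParam mu)) (hΔ : Delta mu f c x t ≠ 0) :
    -conj (barQ mu f c q x t) = -conj (q x t)
      - gramAt (doubleParam mu) (doubleFamily f) (doubleCoef c) x t 1 1 := by
  rw [barQ_eq hΔ, gramAt_double_one_one hmu (by rwa [← Delta_eq]), map_sub]
  ring

theorem hasDerivAt_barQ_x (hmu : Function.Injective (doubleParam mu)) (hΩ : IsOpen Ω)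
    (hf : ∀ j, IsLaxFamily Ω lam q φ (mu j) (f j)) (hxt : (x, t) ∈ Ω)
    (hΔ : Delta mu f c x t ≠ 0) {qx : ℂ} (hq : HasDerivAt (fun y => q y t) qx x) :
    HasDerivAt (fun y => barQ mu f c q y t)
      (qx - gramDeriv (q x t) (-conj (q x t))
        (gramAt (doubleParam mu) (doubleFamily f) (doubleCoef c) x t)
        (momentAt (doubleParam mu) (doubleFamily f) (doubleCoef c) x t) 0 0) x := by
  have hΔ' := hΔ
  rw [Delta_eq] at hΔ'
  refine (hq.sub (hasEntryDerivAt_gramAt_x hmu hΩ (isLaxFamily_double hf) hxt hΔ' 0 0)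
    ).congr_of_eventuallyEq ?_
  filter_upwards [eventually_Delta_x hmu hΩ hf hxt hΔ] with y hy
  exact barQ_eq hy.2

/-- The symmetry of Q holds at all nearby points of the line, so it may be differentiated; no
separate symmetry of the moments is required. -/
theorem conj_gramDeriv (hmu : Function.Injective (doubleParam mu)) (hΩ : IsOpen Ω)
    (hf : ∀ j, IsLaxFamily Ω lam q φ (mu j) (f j)) (hxt : (x, t) ∈ Ω)
    (hΔ : Delta mu f c x t ≠ 0) :
    gramDeriv (q x t) (-conj (q x t))
        (gramAt (doubleParam mu) (doubleFamily f) (doubleCoef c) x t)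
        (momentAt (doubleParam mu) (doubleFamily f) (doubleCoef c) x t) 1 1 =
      -conj (gramDeriv (q x t) (-conj (q x t))
        (gramAt (doubleParam mu) (doubleFamily f) (doubleCoef c) x t)
        (momentAt (doubleParam mu) (doubleFamily f) (doubleCoef c) x t) 0 0) := by
  have hΔ' := hΔ
  rw [Delta_eq] at hΔ'
  have h1 := hasEntryDerivAt_gramAt_x (c := doubleCoef c) hmu hΩ (isLaxFamily_double hf) hxt hΔ'
  refine (h1 1 1).unique ((h1 0 0).star.fun_neg.congr_of_eventuallyEq ?_)
  filter_upwards [eventually_Delta_x hmu hΩ hf hxt hΔ] with y hy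
  exact gramAt_double_one_one hmu (by rw [← Delta_eq]; exact hy.2)

theorem hasDerivAt_barVec_x (hmu : Function.Injective (doubleParam mu)) (hΩ : IsOpen Ω)
    (hf : ∀ j, IsLaxFamily Ω lam q φ (mu j) (f j)) (hxt : (x, t) ∈ Ω)
    (hΔ : Delta mu f c x t ≠ 0) {z : ℂ} (hz : ∀ i, doubleParam mu i ≠ z) {ψ : ℝ → ℝ → Vec2}
    (hψ : HasDerivAt (fun y => ψ y t) (laxU z (q x t) (-conj (q x t)) *ᵥ ψ x t) x) :
    HasDerivAt (fun y => barVec mu f c z ψ y t)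
      (laxU z (barQ mu f c q x t) (-conj (barQ mu f c q x t)) *ᵥ barVec mu f c z ψ x t) x := by
  have hΔ' := hΔ
  rw [Delta_eq] at hΔ'
  rw [hasDerivAt_pi]
  intro k
  refine ((hasEntryDerivAt_dressedCol_x hmu hΩ (isLaxFamily_double hf) hxt hΔ' hz hψ k ()
    ).congr_of_eventuallyEq ?_).congr_deriv ?_
  · filter_upwards [eventually_Delta_x hmu hΩ hf hxt hΔ] with y hy
    exact barVec_eq hy.2 hz ψ k
  · rw [conj_barQ hmu hΔ, barQ_eq hΔ]
    simp only [Matrix.mulVec, dotProduct, barVec_eq hΔ hz, Matrix.mul_apply]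

theorem hasDerivAt_newSource_x (hmu : Function.Injective (doubleParam mu)) (hΩ : IsOpen Ω)
    (hf : ∀ j, IsLaxFamily Ω lam q φ (mu j) (f j)) (hxt : (x, t) ∈ Ω)
    (hΔ : Delta mu f c x t ≠ 0) {j : Fin N} (hc : c j t ≠ 0) :
    HasDerivAt (fun y => newSource mu f c s j y t)
      (laxU (mu j) (barQ mu f c q x t) (-conj (barQ mu f c q x t)) *ᵥ newSource mu f c s j x t)
      x := by
  have hΔ' := hΔ
  rw [Delta_eq] at hΔ'
  rw [hasDerivAt_pi]
  intro k
  refine (((hasEntryDerivAt_dressedColumns_x (c := doubleCoef c) hmu hΩ (isLaxFamily_double hf)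
    hxt hΔ' k (j, false)).const_mul (s j t)).congr_of_eventuallyEq ?_).congr_deriv ?_
  · filter_upwards [eventually_Delta_x hmu hΩ hf hxt hΔ] with y hy
    rw [newSource_eq hy.2 hc]
    rfl
  · rw [conj_barQ hmu hΔ, barQ_eq hΔ, newSource_eq hΔ hc, Matrix.mulVec_smul, laxU_eq,
      Matrix.add_mulVec, Matrix.neg_mulVec, Matrix.smul_mulVec]
    simp only [Matrix.add_apply, Matrix.neg_apply, Matrix.mul_diagonal, Pi.add_apply,
      Pi.neg_apply, Pi.smul_apply, smul_eq_mul, doubleParam, mul_comm _ (mu j)]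
    rfl

end Transformed

/-! ### Assembly of the three assertions -/

section Main

variable {m N : ℕ} {Ω : Set (ℝ × ℝ)} {lam : Fin (m + N) → ℂ} {lamOld : Fin m → ℂ}
  {mu : Fin N → ℂ} {q : ℝ → ℝ → ℂ} {φ : Fin m → ℝ → ℝ → Vec2}
  {f : Fin N → ℂ → ℝ → ℝ → Vec2} {c s : Fin N → ℝ → ℂ} {x t : ℝ}

theorem DistinctSpectrum.injective_doubleParam {M : ℕ} {lam : Fin M → ℂ}
    (h : DistinctSpectrum lam) : Function.Injective (doubleParam lam) := by
  have h1 : doubleParam lam = Sum.elim lam (fun j => -conj (lam j)) ∘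
      fun i => if i.2 then Sum.inr i.1 else Sum.inl i.1 := by
    funext ⟨j, b⟩
    cases b <;> rfl
  rw [h1]
  refine h.comp ?_
  rintro ⟨j, b⟩ ⟨k, b'⟩ hjk
  cases b <;> cases b' <;> simp_all

theorem doubleParam_comp {M M' : ℕ} (lam : Fin M → ℂ) (e : Fin M' → Fin M) (i : Fin M' × Bool) :
    doubleParam (fun j => lam (e j)) i = doubleParam lam (e i.1, i.2) := by
  obtain ⟨j, b⟩ := i
  cases b <;> rfl

theorem DistinctSpectrum.injective_natAdd (h : DistinctSpectrum lam)
    (hmu : mu = fun j => lam (Fin.natAdd m j)) : Function.Injective (doubleParam mu) := by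
  subst hmu
  rintro ⟨j, b⟩ ⟨k, b'⟩ hjk
  rw [doubleParam_comp lam (Fin.natAdd m), doubleParam_comp lam (Fin.natAdd m)] at hjk
  have := h.injective_doubleParam hjk
  simp_all

theorem DistinctSpectrum.natAdd_ne_castAdd (h : DistinctSpectrum lam)
    (hlamOld : lamOld = fun j => lam (Fin.castAdd N j))
    (hmu : mu = fun j => lam (Fin.natAdd m j)) (i : Fin N × Bool) (k : Fin m × Bool) :
    doubleParam mu i ≠ doubleParam lamOld k := by
  subst hmu hlamOld
  intro hik
  rw [doubleParam_comp lam (Fin.natAdd m), doubleParam_comp lam (Fin.castAdd N)] at hik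
  have h1 := congrArg (fun p => (p.1 : ℕ)) (h.injective_doubleParam hik)
  have h2 := k.1.isLt
  simp at h1
  omega

theorem mul_diagonal_mul_transpose_apply {ι : Type} [Fintype ι] [DecidableEq ι]
    (M : Matrix (Fin 2) ι ℂ) (e : ι → ℂ) (a : Fin 2) :
    (M * Matrix.diagonal e * Mᵀ) a a = ∑ i, e i * M a i ^ 2 := by
  rw [Matrix.mul_apply]
  refine Finset.sum_congr rfl fun i _ => ?_
  rw [Matrix.mul_diagonal, Matrix.transpose_apply]
  ring

theorem signed_square_sum {M : Matrix (Fin 2) (Fin m × Bool) ℂ} {w : Fin m → Vec2}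
    (hM : ∀ k, Mᵀ k = doubleVec w k) :
    (M * signMat m * Mᵀ) 0 0 = ∑ j, ((w j 0) ^ 2 - (conj (w j 1)) ^ 2) := by
  rw [signMat, mul_diagonal_mul_transpose_apply, Fintype.sum_prod_type]
  refine Finset.sum_congr rfl fun j _ => ?_
  have h1 : M 0 (j, false) = w j 0 := congrFun (hM (j, false)) 0
  have h2 : M 0 (j, true) = -conj (w j 1) := congrFun (hM (j, true)) 0
  rw [Fintype.sum_bool, h1, h2]
  simp only [doubleSign]
  ring

/-- The sign in `dressedColumns_true` disappears on squaring, while the coefficient -c_j* supplies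
the minus sign of the conjugate term and `s` absorbs the weight into the vector. -/
theorem new_square_sum (hmu : Function.Injective (doubleParam mu)) (hΔ : Delta mu f c x t ≠ 0)
    (hc : ∀ j, c j t ≠ 0) :
    (dressedColumns (doubleParam mu) (doubleFamily f) (doubleCoef c) x t
        * Matrix.diagonal (doubleCoefDeriv s t)
        * (dressedColumns (doubleParam mu) (doubleFamily f) (doubleCoef c) x t)ᵀ) 0 0 =
      ∑ j, ((newSource mu f c s j x t 0) ^ 2 - (conj (newSource mu f c s j x t 1)) ^ 2) := by
  rw [mul_diagonal_mul_transpose_apply, Fintype.sum_prod_type]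
  refine Finset.sum_congr rfl fun j _ => ?_
  have h2 := congrFun (dressedColumns_true hΔ hmu j) 0
  rw [Fintype.sum_bool, newSource_eq hΔ (hc j)]
  simp only [Matrix.transpose_apply, Pi.neg_apply, sMinus, Matrix.cons_val_zero, neg_neg] at h2
  simp only [h2, doubleCoefDeriv, Pi.smul_apply, smul_eq_mul, Matrix.transpose_apply, map_mul,
    map_pow]
  ring

/-- Stated for a general summand so as to serve both the Lax matrix and the quadratic source terms.
-/
theorem sum_barSources (hmu' : mu = fun j => lam (Fin.natAdd m j))
    (hlamOld : lamOld = fun j => lam (Fin.castAdd N j)) (F : ℂ → Vec2 → ℂ) (x t : ℝ) :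
    ∑ j, F (lam j) (barSources lam f c s φ j x t) =
      ∑ j, F (lamOld j) (barVec mu f c (lamOld j) (φ j) x t)
        + ∑ j, F (mu j) (newSource mu f c s j x t) := by
  subst hmu' hlamOld
  rw [Fin.sum_univ_add]
  simp only [barSources, Fin.append_left, Fin.append_right]

/-- The source part of the temporal Lax matrix after the transformation. -/
theorem sum_barSources_mulVec (hmu' : mu = fun j => lam (Fin.natAdd m j))
    (hlamOld : lamOld = fun j => lam (Fin.castAdd N j))
    (hmu : Function.Injective (doubleParam mu))
    (hne : ∀ i k, doubleParam mu i ≠ doubleParam lamOld k) (hΔ : Delta mu f c x t ≠ 0)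
    (hc : ∀ j, c j t ≠ 0) (z : ℂ) (ψ : Matrix (Fin 2) Unit ℂ) (a : Fin 2) :
    ((∑ j, ((1 / (z - lam j)) • sourceH (barSources lam f c s φ j x t)
        - (1 / (z + conj (lam j))) • sourceH (NLSMinus.sMinus (barSources lam f c s φ j x t))))
          *ᵥ fun k => ψ k ()) a =
      (dressedSourceMat (doubleParam mu) (doubleFamily f) (doubleCoef c) lamOld φ x t * signMat m
          * cauchyMat (doubleParam lamOld) (fun _ => z)
            (dressedSourceMat (doubleParam mu) (doubleFamily f) (doubleCoef c) lamOld φ x t) ψ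
        + dressedColumns (doubleParam mu) (doubleFamily f) (doubleCoef c) x t
          * Matrix.diagonal (doubleCoefDeriv s t)
          * cauchyMat (doubleParam mu) (fun _ => z)
            (dressedColumns (doubleParam mu) (doubleFamily f) (doubleCoef c) x t) ψ) a () := by
  rw [Matrix.add_apply, signMat, ← sum_smul_sourceH_mulVec, ← sum_smul_sourceH_mulVec,
    Matrix.sum_mulVec, Matrix.sum_mulVec, Matrix.sum_mulVec, Finset.sum_apply, Finset.sum_apply,
    Finset.sum_apply]
  rw [sum_barSources hmu' hlamOld (fun l v => (((1 / (z - l)) • sourceH v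
    - (1 / (z + conj l)) • sourceH (NLSMinus.sMinus v)) *ᵥ fun k => ψ k ()) a)]
  congr 1
  · rw [Fintype.sum_prod_type]
    refine Finset.sum_congr rfl fun j _ => ?_
    rw [Fintype.sum_bool, dressedSourceMat_column hΔ hmu hne, dressedSourceMat_column hΔ hmu hne,
      Matrix.sub_mulVec, Pi.sub_apply, sub_eq_neg_add, ← Pi.neg_apply, ← Matrix.neg_mulVec,
      ← neg_smul]
    simp only [doubleVec, doubleParam, doubleSign, sub_neg_eq_add, neg_div]
    rfl
  · rw [Fintype.sum_prod_type]
    refine Finset.sum_congr rfl fun j _ => ?_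
    rw [Fintype.sum_bool, dressedColumns_true hΔ hmu, newSource_eq hΔ (hc j), sMinus_smul,
      sourceH_smul, sourceH_smul, sourceH_neg, smul_smul, smul_smul, Matrix.sub_mulVec,
      Pi.sub_apply, sub_eq_neg_add, ← Pi.neg_apply, ← Matrix.neg_mulVec, ← neg_smul]
    simp only [doubleParam, doubleCoefDeriv, sub_neg_eq_add, neg_div, map_pow, one_div_mul_eq_div]
    rfl

theorem isLaxSolution_barVec (hΩ : IsOpen Ω) (hlam : DistinctSpectrum lam)
    (hlamOld : lamOld = fun j => lam (Fin.castAdd N j))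
    (hmu : mu = fun j => lam (Fin.natAdd m j))
    (hsol : IsNLSMinusSolution Ω lamOld q φ)
    (hf : ∀ j, IsLaxFamily Ω lamOld q φ (mu j) (f j))
    (hc : ∀ j x t, (x, t) ∈ Ω → HasDerivAt (c j) (s j t ^ 2) t)
    {z : ℂ} {ψ : ℝ → ℝ → Vec2} (hz : ∀ j, z ≠ lam j ∧ z ≠ -conj (lam j))
    (hψ : IsLaxSolution Ω lamOld q φ z ψ) :
    IsLaxSolution {p ∈ {p ∈ Ω | Delta mu f c p.1 p.2 ≠ 0} | ∀ j, c j p.2 ≠ 0} lam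
      (barQ mu f c q) (barSources lam f c s φ) z (barVec mu f c z ψ) := by
  rintro x t ⟨⟨hxt, hΔ⟩, hc0⟩
  have hinj := hlam.injective_natAdd hmu
  have hne := hlam.natAdd_ne_castAdd hlamOld hmu
  have hz1 : ∀ k, z ≠ doubleParam lam k := by
    rintro ⟨j, b⟩
    cases b
    · exact (hz j).1
    · exact (hz j).2
  have hzmu : ∀ i, doubleParam mu i ≠ z := fun i => by
    rw [hmu, doubleParam_comp lam]; exact (hz1 _).symm
  have hzold : ∀ k, z ≠ doubleParam lamOld k := fun k => by
    rw [hlamOld, doubleParam_comp lam]; exact hz1 _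
  obtain ⟨hx, ht⟩ := hψ x t hxt
  refine ⟨hasDerivAt_barVec_x hinj hΩ hf hxt hΔ hzmu hx, ?_⟩
  have hcd := fun j => hc j x t hxt
  have hΔ' := hΔ
  rw [Delta_eq] at hΔ'
  rw [laxT_double] at ht
  have h1 := hasEntryDerivAt_dressedCol_t hinj hΩ (isLaxFamily_double hf) hne hxt hΔ'
    (hasDerivAt_doubleCoef hcd) hzmu hzold (fun k => (hzold k).symm) ht
  have hqx := (hsol x t hxt).2.1.1.self_of_nhds.hasDerivAt
  have hqx' := (hasDerivAt_barQ_x hinj hΩ hf hxt hΔ hqx).deriv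
  have hψeq : barVec mu f c z ψ x t =
      fun k => dressedCol (doubleParam mu) (doubleFamily f) (doubleCoef c) z ψ x t k () :=
    funext fun k => barVec_eq hΔ hzmu ψ k
  rw [hasDerivAt_pi]
  intro k
  refine ((h1 k ()).congr_of_eventuallyEq ?_).congr_deriv ?_
  -- Only Δ has to stay nonzero for nearby times: ψ̄ contains no division by c_j, and the sources
  -- enter only at the point itself.
  · filter_upwards [eventually_Delta_t hinj hne hΩ hf hxt hcd hΔ] with τ hτ
    exact barVec_eq hτ hzmu ψ k
  · rw [hqx', conj_barQ hinj hΔ, barQ_eq hΔ, map_sub, neg_sub', ← conj_gramDeriv hinj hΩ hf hxt hΔ,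
      Matrix.add_mulVec, Pi.add_apply, hψeq,
      sum_barSources_mulVec hmu hlamOld hinj hne hΔ hc0, add_assoc, Matrix.add_apply]
    rfl

theorem isNLSMinusSolution_bar (hΩ : IsOpen Ω) (hlam : DistinctSpectrum lam)
    (hlamOld : lamOld = fun j => lam (Fin.castAdd N j))
    (hmu : mu = fun j => lam (Fin.natAdd m j))
    (hsol : IsNLSMinusSolution Ω lamOld q φ)
    (hf : ∀ j, IsLaxFamily Ω lamOld q φ (mu j) (f j))
    (hc : ∀ j x t, (x, t) ∈ Ω → HasDerivAt (c j) (s j t ^ 2) t) :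
    IsNLSMinusSolution {p ∈ {p ∈ Ω | Delta mu f c p.1 p.2 ≠ 0} | ∀ j, c j p.2 ≠ 0} lam
      (barQ mu f c q) (barSources lam f c s φ) := by
  rintro x t ⟨⟨hxt, hΔ⟩, hc0⟩
  have hinj := hlam.injective_natAdd hmu
  have hne := hlam.natAdd_ne_castAdd hlamOld hmu
  have hcd := fun j => hc j x t hxt
  have hΔ' := hΔ
  rw [Delta_eq] at hΔ'
  obtain ⟨hφ, hq2, hqt⟩ := hsol x t hxt
  have hev := eventually_Delta_x hinj hΩ hf hxt hΔ
  have hqx : ∀ᶠ y in 𝓝 x, HasDerivAt (fun y => barQ mu f c q y t)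
      (deriv (fun y => q y t) y - gramDeriv (q y t) (-conj (q y t))
        (gramAt (doubleParam mu) (doubleFamily f) (doubleCoef c) y t)
        (momentAt (doubleParam mu) (doubleFamily f) (doubleCoef c) y t) 0 0) y := by
    filter_upwards [hev] with y hy
    exact hasDerivAt_barQ_x hinj hΩ hf hy.1 hy.2
      (hsol y t hy.1).2.1.1.self_of_nhds.hasDerivAt
  have hqxx : HasDerivAt (deriv fun y => barQ mu f c q y t)
      (deriv (deriv fun y => q y t) x - gramDeriv2 (q x t) (-conj (q x t))
        (deriv (fun y => q y t) x) (-conj (deriv (fun y => q y t) x))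
        (gramAt (doubleParam mu) (doubleFamily f) (doubleCoef c) x t)
        (momentAt (doubleParam mu) (doubleFamily f) (doubleCoef c) x t)
        (momentAt2 (doubleParam mu) (doubleFamily f) (doubleCoef c) x t) 0 0) x := by
    refine (hq2.2.hasDerivAt.sub (hasEntryDerivAt_gramDeriv_x (c := doubleCoef c) hinj hΩ
      (isLaxFamily_double hf) hxt hΔ' hq2.1.self_of_nhds.hasDerivAt 0 0)).congr_of_eventuallyEq ?_
    filter_upwards [hqx] with y hy using hy.deriv
  refine ⟨?_, ⟨hqx.mono fun y hy => hy.differentiableAt, hqxx.differentiableAt⟩, ?_⟩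
  · refine Fin.addCases (fun j => ?_) (fun j => ?_)
    · have h1 := hasDerivAt_barVec_x (c := c) (z := lamOld j) hinj hΩ hf hxt hΔ
        (fun i => hne i (j, false)) (hφ j)
      subst hmu hlamOld
      simpa only [barSources, Fin.append_left] using h1
    · have h1 := hasDerivAt_newSource_x (s := s) hinj hΩ hf hxt hΔ (hc0 j)
      subst hmu hlamOld
      simpa only [barSources, Fin.append_right] using h1
  · have h1 := hqt.sub (hasEntryDerivAt_gramAt_t hinj hΩ (isLaxFamily_double hf) hne hxt hΔ'
      (hasDerivAt_doubleCoef hcd) 0 0)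
    refine (h1.congr_of_eventuallyEq ?_).congr_deriv ?_
    · filter_upwards [eventually_Delta_t hinj hne hΩ hf hxt hcd hΔ] with τ hτ
      exact barQ_eq hτ
    · have hflow := dressed_potential_flow (q x t) (-conj (q x t)) (deriv (fun y => q y t) x)
        (-conj (deriv (fun y => q y t) x)) (deriv (deriv fun y => q y t) x)
        (gramAt (doubleParam mu) (doubleFamily f) (doubleCoef c) x t)
        (momentAt (doubleParam mu) (doubleFamily f) (doubleCoef c) x t)
        (momentAt2 (doubleParam mu) (doubleFamily f) (doubleCoef c) x t)
        (gram_transpose _ (resolvent_transpose hinj))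
        (moment_transpose (matA_mul_resolvent hΔ') (resolvent_mul_matA hΔ')
          (resolvent_transpose hinj) (Matrix.diagonal_transpose _) (matA_commutator _ _ _ _ hinj))
        (by simp only [momentAt2, Matrix.transpose_mul, Matrix.transpose_transpose,
          Matrix.diagonal_transpose, resolvent_transpose hinj, Matrix.mul_assoc])
      rw [← barQ_eq hΔ, ← conj_barQ hinj hΔ] at hflow
      rw [hqxx.deriv, sum_barSources hmu hlamOld (fun _ v => v 0 ^ 2 - conj (v 1) ^ 2),
        Matrix.sub_apply, Matrix.sub_apply, Matrix.add_apply, Matrix.smul_apply, smul_eq_mul,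
        new_square_sum hinj hΔ hc0, signed_square_sum (M := sourceMat φ x t)
          (w := fun j => φ j x t) (fun _ => rfl),
        signed_square_sum (dressedSourceMat_column hΔ hinj hne), ← Complex.mul_conj',
        ← Complex.mul_conj']
      -- The old source sum has cancelled between q_t and the derivative of Q; what is left is the
      -- source-free identity.
      linear_combination -Complex.I * hflow

/-- The moment enters only through the difference of its off-diagonal entries, which `hM` expresses
by Q. The right-hand side is qr - (q - `Q 0 0`)(r - `Q 1 1`). -/
theorem gramDeriv_zero_one (q r : ℂ) (Q M : Matrix (Fin 2) (Fin 2) ℂ) (hQ : Qᵀ = Q)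
    (hM : Mᵀ = M - (1 / 2 : ℂ) • (Q * matJ * Q)) :
    gramDeriv q r Q M 0 1 = q * Q 1 1 + Q 0 0 * r - Q 0 0 * Q 1 1 := by
  obtain ⟨a, b, d, rfl⟩ := exists_eq_of_transpose_eq hQ
  obtain ⟨m₁, m₂, m₃, m₄, rfl⟩ := exists_eq_of_eta M
  have h := congrFun (congrFun hM 0) 1
  simp [matJ] at h
  simp [potential, pauli1, pauli3, gramDeriv, transpose_of_fin_two]
  linear_combination h

/-- The logarithmic derivative of `det A` is an entry of the Gram matrix. -/
theorem trace_adjugate_mul {ι : Type} [Fintype ι] [DecidableEq ι] {κ : ι → ℂ}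
    {g : ι → ℂ → ℝ → ℝ → Vec2} {c : ι → ℝ → ℂ} (hκ : Function.Injective κ)
    (hdet : (matA (familyPairs κ g c x t)).det ≠ 0) :
    ((matA (familyPairs κ g c x t)).adjugate * ((1 / 2 : ℂ) •
        ((columns κ g x t)ᵀ * pauli1 * columns κ g x t))).trace =
      gramAt κ g c x t 0 1 * (matA (familyPairs κ g c x t)).det := by
  have h1 : (matA (familyPairs κ g c x t)).adjugate =
      (matA (familyPairs κ g c x t)).det • resolvent κ g c x t := by
    rw [resolvent, Matrix.inv_def, Ring.inverse_eq_inv', smul_smul, mul_inv_cancel₀ hdet, one_smul]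
  have h2 : (resolvent κ g c x t * ((columns κ g x t)ᵀ * pauli1 * columns κ g x t)).trace =
      (pauli1 * gramAt κ g c x t).trace := by
    rw [Matrix.mul_assoc (columns κ g x t)ᵀ, ← Matrix.mul_assoc, Matrix.trace_mul_comm,
      gramAt, gram]
    simp only [Matrix.mul_assoc]
  have h3 : gramAt κ g c x t 1 0 = gramAt κ g c x t 0 1 :=
    congrFun (congrFun (gram_transpose _ (resolvent_transpose hκ)) 0) 1
  rw [h1, Matrix.smul_mul, Matrix.mul_smul, Matrix.trace_smul, Matrix.trace_smul, h2,
    Matrix.trace_fin_two, Matrix.mul_apply, Matrix.mul_apply, Fin.sum_univ_two, Fin.sum_univ_two,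
    h3]
  simp [pauli1]
  ring

/-- Jacobi's formula gives the logarithmic derivative of Δ as ½ tr(σ₁Q), which is `Q 0 1`. A second
derivative is an entry of `gramDeriv`, and the reduction turns products qr into -|q|². -/
theorem log_norm_Delta (hΩ : IsOpen Ω) (hlam : DistinctSpectrum lam)
    (hmu : mu = fun j => lam (Fin.natAdd m j))
    (hf : ∀ j, IsLaxFamily Ω lamOld q φ (mu j) (f j)) (hxt : (x, t) ∈ Ω)
    (hΔ : Delta mu f c x t ≠ 0) :
    (Delta mu f c x t).im = 0 ∧
      TwiceDifferentiableAt (fun y => Real.log ‖Delta mu f c y t‖) x ∧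
      ‖barQ mu f c q x t‖ ^ 2 =
        ‖q x t‖ ^ 2 + deriv (deriv (fun y => Real.log ‖Delta mu f c y t‖)) x := by
  have hinj := hlam.injective_natAdd hmu
  have hreal : ∀ y, ((Delta mu f c y t).re : ℂ) = Delta mu f c y t := fun y =>
    Complex.conj_eq_iff_re.1 (conj_Delta hinj)
  have hre : ∀ {g : ℝ → ℂ} {g' : ℂ} {y : ℝ}, HasDerivAt g g' y →
      HasDerivAt (fun y => (g y).re) g'.re y := fun h =>
    Complex.reCLM.hasFDerivAt.comp_hasDerivAt _ h
  have hlog : (fun y => Real.log ‖Delta mu f c y t‖) =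
      fun y => Real.log (Delta mu f c y t).re := funext fun y => by
    rw [← hreal y, Complex.norm_real, Real.norm_eq_abs, Real.log_abs, Complex.ofReal_re]
  have hev := eventually_Delta_x hinj hΩ hf hxt hΔ
  have h1 : ∀ᶠ y in 𝓝 x, HasDerivAt (fun y => Real.log ‖Delta mu f c y t‖)
      (gramAt (doubleParam mu) (doubleFamily f) (doubleCoef c) y t 0 1).re y := by
    filter_upwards [hev] with y hy
    rw [hlog]
    have hy' := hy.2
    rw [Delta_eq] at hy'
    have hd := (hasEntryDerivAt_matA_x (c := doubleCoef c) hinj hΩ (isLaxFamily_double hf) hy.1).det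
    rw [trace_adjugate_mul hinj hy'] at hd
    simp only [← Delta_eq] at hd
    have hre0 : (Delta mu f c y t).re ≠ 0 := fun h0 => hy.2 (by rw [← hreal y, h0]; simp)
    refine ((hre hd).log hre0).congr_deriv ?_
    rw [div_eq_iff hre0, ← hreal y, Complex.re_mul_ofReal, Complex.ofReal_re]
  have hΔ' := hΔ
  rw [Delta_eq] at hΔ'
  have h2 : HasDerivAt (deriv fun y => Real.log ‖Delta mu f c y t‖) _ x :=
    (hre (hasEntryDerivAt_gramAt_x (c := doubleCoef c) hinj hΩ (isLaxFamily_double hf) hxt hΔ'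
      0 1)).congr_of_eventuallyEq (h1.mono fun y hy => hy.deriv)
  refine ⟨by rw [← hreal x, Complex.ofReal_im], ⟨h1.mono fun y hy => hy.differentiableAt,
    h2.differentiableAt⟩, ?_⟩
  rw [h2.deriv]
  have h3 := gramDeriv_zero_one (q x t) (-conj (q x t))
    (gramAt (doubleParam mu) (doubleFamily f) (doubleCoef c) x t)
    (momentAt (doubleParam mu) (doubleFamily f) (doubleCoef c) x t)
    (gram_transpose _ (resolvent_transpose hinj))
    (moment_transpose (matA_mul_resolvent hΔ') (resolvent_mul_matA hΔ')
      (resolvent_transpose hinj) (Matrix.diagonal_transpose _) (matA_commutator _ _ _ _ hinj))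
  have h4 : ((‖barQ mu f c q x t‖ ^ 2 - ‖q x t‖ ^ 2 : ℝ) : ℂ) =
      gramDeriv (q x t) (-conj (q x t))
        (gramAt (doubleParam mu) (doubleFamily f) (doubleCoef c) x t)
        (momentAt (doubleParam mu) (doubleFamily f) (doubleCoef c) x t) 0 1 := by
    have h5 := conj_barQ (q := q) hinj hΔ
    push_cast
    rw [h3, ← Complex.mul_conj', ← Complex.mul_conj']
    rw [neg_eq_iff_eq_neg.1 h5, barQ_eq hΔ]
    ring
  rw [← h4, Complex.ofReal_re]
  ring

end Main

end NLSMinus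

end

theorem mainTheorem8 (m N : ℕ) (Ω : Set (ℝ × ℝ)) (hΩ : IsOpen Ω)
    (lam : Fin (m + N) → ℂ) (hlam : NLSMinus.DistinctSpectrum lam)
    (lamOld : Fin m → ℂ) (hlamOld : lamOld = fun j => lam (Fin.castAdd N j))
    (mu : Fin N → ℂ) (hmu : mu = fun j => lam (Fin.natAdd m j))
    (q : ℝ → ℝ → ℂ) (φ : Fin m → ℝ → ℝ → NLSMinus.Vec2)
    (hsol : NLSMinus.IsNLSMinusSolution Ω lamOld q φ)
    (f : Fin N → ℂ → ℝ → ℝ → NLSMinus.Vec2)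
    (hf : ∀ j, NLSMinus.IsLaxFamily Ω lamOld q φ (mu j) (f j))
    (c s : Fin N → ℝ → ℂ)
    (hc : ∀ j x t, (x, t) ∈ Ω → HasDerivAt (c j) (s j t ^ 2) t)
    (Ω₀ : Set (ℝ × ℝ)) (hΩ₀ : Ω₀ = {p ∈ Ω | NLSMinus.Delta mu f c p.1 p.2 ≠ 0})
    (Ω₁ : Set (ℝ × ℝ)) (hΩ₁ : Ω₁ = {p ∈ Ω₀ | ∀ j, c j p.2 ≠ 0}) :
    (∀ (z : ℂ) (ψ : ℝ → ℝ → NLSMinus.Vec2),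
      (∀ j, z ≠ lam j ∧ z ≠ -(starRingEnd ℂ) (lam j)) →
      NLSMinus.IsLaxSolution Ω lamOld q φ z ψ →
      NLSMinus.IsLaxSolution Ω₁ lam (NLSMinus.barQ mu f c q)
        (NLSMinus.barSources lam f c s φ) z (NLSMinus.barVec mu f c z ψ)) ∧
    NLSMinus.IsNLSMinusSolution Ω₁ lam (NLSMinus.barQ mu f c q)
      (NLSMinus.barSources lam f c s φ) ∧
    (∀ x t : ℝ, (x, t) ∈ Ω₀ →
      (NLSMinus.Delta mu f c x t).im = 0 ∧
      NLSMinus.TwiceDifferentiableAt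
        (fun y => Real.log ‖NLSMinus.Delta mu f c y t‖) x ∧
      ‖NLSMinus.barQ mu f c q x t‖ ^ 2 =
        ‖q x t‖ ^ 2 + deriv (deriv (fun y => Real.log ‖NLSMinus.Delta mu f c y t‖)) x) := by
  subst hΩ₁ hΩ₀
  refine ⟨fun z ψ hz hψ => ?_, ?_, fun x t hxt => ?_⟩
  · exact NLSMinus.isLaxSolution_barVec hΩ hlam hlamOld hmu hsol hf hc hz hψ
  · exact NLSMinus.isNLSMinusSolution_bar hΩ hlam hlamOld hmu hsol hf hc
  · exact NLSMinus.log_norm_Delta hΩ hlam hmu hf hxt.1 hxt.2
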